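/- Let $l:\mathbb R\to\mathbb R$ be convex, nondecreasing and Lipschitz (e.g. the logistic loss $l(s)=\log(1+e^s)$ or the hinge loss $l(s)=\max(0,1+s)$), and let $0<c\le 1$, $\alpha>0$, $R>0$, $C>0$, $\gamma_0>0$. *Loss.* For a finite multiset $S$ of reals let $\hat q_m(S)$ be the mean of the $k=\lfloor c|S|\rfloor$ smallest elements of $S$, counted with multiplicity ($\hat q_m(S)=0$ if $k=0$). For labelled points $Z=((x_1,y_1),\dots,(x_n,y_n))$ with $x_i\in\mathbb R^d$, $y_i\in\{-1,1\}$, and a set $A\subseteq\{1,\dots,n\}$, the quantile loss of the linear model $x\mapsto w^\top x$ is $$L_q(w;Z,A)=\frac1n\sum_{i=1}^n(1-y_i)\,l\bigl(w^\top x_i-\hat q_m(\{w^\top x_j: j\in A\})\bigr).$$ *Algorithm.* Let $Z=((x_i,y_i))_{i\le N}$ be a data set with $\|x_i\|\le R$, let $A\subseteq\{1,\dots,N\}$ with $|A|\ge\alpha N$, write $L_q(w;Z)=L_q(w;Z,A)$, and let $1\le b\le N$, $T\ge1$. For $t=0,\dots,T-1$ let $\hat Z_t$ be a minibatch of $b$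 elements of $Z$, drawn uniformly at random, either with replacement (i.i.d.) for all $t$ or without replacement within the batch for all $t$ (the minibatches may be independent of each other, or dependent in any way), and let $\hat A_t$ consist of the elements of $\hat Z_t$ that belong to $A$. Starting from any (possibly random) $w_0$ with $\|w_0\|\le C$, put $$w_{t+1}=\Pi_C(w_t-\gamma g_t),\qquad g_t\in\partial_w L_q(w_t;\hat Z_t,\hat A_t),\qquad \gamma=\gamma_0/\sqrt T,$$ where $\partial_w$ is the (convex) subdifferential, so that $g_t$ is the gradient wherever the loss is differentiable, and $\Pi_C$ is the Euclidean projection onto $\{\|w\|\le C\}$. Let $w^*=\frac1T\sum_{t=0}^{T-1}w_t$. *Claim.* There are constants $K_1,K_2$ that depend only on $l,c,\alpha,R,C,\gamma_0$ (not on $d,N,b,T,\delta$, the data, $A$, or the run) such that for every $0<\delta<1$, with probability at least $1-\delta$, simultaneously for all $w\in\mathbb R^d$ with $\|w\|\le C$, $$L_q(w^*;Z)\le L_q(w;Z)+K_1\sqrt{\frac1b\log\frac T\delta}+K_2\sqrt{\frac1T}.$$ -/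

import Mathlib

open MeasureTheory ProbabilityTheory
open scoped NNReal RealInnerProductSpace

noncomputable section

namespace QuantileSGD

/-- The lower-bound quantile estimator at level `c`: the mean of the bottom `k` elements of the
multiset `S`, where `k = ⌊c |S|⌋` is the largest integer with `k / |S| ≤ c`.
(If `k = 0` there is nothing to average and the value is `0`.) -/
def bottomMean (c : ℝ) (S : Multiset ℝ) : ℝ :=
  ((S.sort (· ≤ ·)).take ⌊c * (Multiset.card S : ℝ)⌋₊).sum / (⌊c * (Multiset.card S : ℝ)⌋₊ : ℝ)

/-- The scores `⟪w, x i⟫`, `i ∈ A`, of a linear model, with multiplicity. -/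
def scores {d n : ℕ} (x : Fin n → EuclideanSpace ℝ (Fin d)) (A : Finset (Fin n))
    (w : EuclideanSpace ℝ (Fin d)) : Multiset ℝ :=
  A.val.map fun i => ⟪w, x i⟫

/-- The (normalized) quantile loss of the linear model `w` on the labelled points
`(x i, y i)`, `i < n`, with constrained subset `A` and lower-bound quantile estimator. -/
def quantileLoss (l : ℝ → ℝ) (c : ℝ) {d n : ℕ} (x : Fin n → EuclideanSpace ℝ (Fin d))
    (y : Fin n → ℝ) (A : Finset (Fin n)) (w : EuclideanSpace ℝ (Fin d)) : ℝ :=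
  (∑ i, (1 - y i) * l (⟪w, x i⟫ - bottomMean c (scores x A w))) / n

/-- The quantile loss on the minibatch which consists of the data points with indices
`z 0, …, z (b - 1)`; its constrained subset consists of the sampled points that lie in `A`. -/
def batchLoss (l : ℝ → ℝ) (c : ℝ) {d N b : ℕ} (x : Fin N → EuclideanSpace ℝ (Fin d))
    (y : Fin N → ℝ) (A : Finset (Fin N)) (z : Fin b → Fin N)
    (w : EuclideanSpace ℝ (Fin d)) : ℝ :=
  quantileLoss l c (fun j => x (z j)) (fun j => y (z j))
    (Finset.univ.filter fun j => z j ∈ A) w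

/-- `g` is a subgradient of `F` at `w`. -/
def IsSubgradientAt {d : ℕ} (F : EuclideanSpace ℝ (Fin d) → ℝ)
    (w g : EuclideanSpace ℝ (Fin d)) : Prop :=
  ∀ v, F w + ⟪g, v - w⟫ ≤ F v

/-- Euclidean projection onto the closed ball of radius `C` about the origin. -/
def projBall {d : ℕ} (C : ℝ) (v : EuclideanSpace ℝ (Fin d)) : EuclideanSpace ℝ (Fin d) :=
  if ‖v‖ ≤ C then v else (C / ‖v‖) • v

/-- `w 0, …, w T` are the iterates of projected (sub)gradient descent over `‖w‖ ≤ C` with learning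
rate `γ`, where step `t` uses the objective `F t`. -/
def IsSGDRun {d : ℕ} (F : ℕ → EuclideanSpace ℝ (Fin d) → ℝ) (C γ : ℝ) (T : ℕ)
    (w : ℕ → EuclideanSpace ℝ (Fin d)) : Prop :=
  ‖w 0‖ ≤ C ∧ ∀ t < T, ∃ g, IsSubgradientAt (F t) (w t) g ∧ w (t + 1) = projBall C (w t - γ • g)

/-- The average of the iterates `w 0, …, w (T - 1)`. -/
def averageIterate {d : ℕ} (T : ℕ) (w : ℕ → EuclideanSpace ℝ (Fin d)) :
    EuclideanSpace ℝ (Fin d) :=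
  (T : ℝ)⁻¹ • ∑ t ∈ Finset.range T, w t

/-- The minibatches `Z 0, …, Z (T - 1)` are uniformly random samples of `b` of the `N` indices,
either all drawn i.i.d. (with replacement) or all drawn without replacement. Nothing is
required of their joint law. -/
def IsMinibatchSampling {Ω : Type*} [MeasurableSpace Ω] (μ : Measure Ω) {N b : ℕ} (T : ℕ)
    (Z : ℕ → Ω → Fin b → Fin N) : Prop :=
  (∀ t < T, HasLaw (Z t) (uniformOn (Set.univ : Set (Fin b → Fin N))) μ) ∨
  (∀ t < T, HasLaw (Z t) (uniformOn {z : Fin b → Fin N | Function.Injective z}) μ)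

end QuantileSGD

end

/-! Two facts carry the theorem: projected subgradient descent has small regret against the sequence
of minibatch losses it sees, and with high probability every minibatch loss is close to the full
loss uniformly over the ball `‖w‖ ≤ C`. Uniformity makes the dependence of the iterates on the
batches, and of the batches on each other, harmless: on the good event the rest is deterministic,
and a union bound over `T` steps suffices.

The quantile is controlled by a variational formula: `k` times the mean of the `k` smallest elements
of `S` is the maximum over `τ` of `k * τ - ∑ (τ - s)₊`. Hence it is concave in the scores, so the
loss is convex when `l` is convex and monotone and labels are `±1`. It also reduces the error of the
batch quantile to uniform deviations of hinge averages `(τ - ⟪w, x⟫)₊` and of the frequency of `A`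
(`mul_abs_sub_le_of_variational`, `abs_bottomMean_scores_sub_le`). With the quantile offset frozen,
the loss is an average of Lipschitz functions of `⟪w, x⟫ - a`.

These deviations are bounded through exponential moments, free of the dimension. Sampling without
replacement is dominated by sampling with replacement (`sum_injective_exp_iSup_le`); symmetrization
introduces random signs (`sum_exp_iSup_centered_le`); contraction replaces Lipschitz functions by
linear ones (`sum_exp_iSup_contraction`); the supremum of the linear process is at most a multiple
of the norm of a Rademacher sum in a Hilbert space, whose `cosh` moments follow from the
parallelogram law (`sum_cosh_norm_le`). Chernoff's bound then gives `card_deviation_le`. -/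

namespace QuantileSGD

section Rademacher

/-! ### Exponential moments of Rademacher sums -/

/-- The real sign attached to a Boolean. -/
def boolSign (e : Bool) : ℝ := if e then 1 else -1

@[simp] lemma boolSign_true : boolSign true = 1 := rfl

@[simp] lemma boolSign_false : boolSign false = -1 := rfl

lemma boolSign_not (e : Bool) : boolSign (!e) = -boolSign e := by
  cases e <;> simp

lemma sum_pi_bool_succ {n : ℕ} (g : (Fin (n + 1) → Bool) → ℝ) :
    ∑ ε, g ε = ∑ ε : Fin n → Bool,
      (g (Fin.cons (α := fun _ => Bool) true ε) + g (Fin.cons (α := fun _ => Bool) false ε)) := by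
  rw [← (Fin.consEquiv fun _ : Fin (n + 1) => Bool).sum_comp, Fintype.sum_prod_type]
  simp [Finset.sum_add_distrib, Fin.consEquiv]

lemma exp_sub_exp_le {a b a' b' : ℝ} (hab : b ≤ a) (hb : b ≤ b') (h : a - b ≤ a' - b') :
    Real.exp a - Real.exp b ≤ Real.exp a' - Real.exp b' := by
  have h1 : Real.exp a - Real.exp b = Real.exp b * (Real.exp (a - b) - 1) := by
    rw [mul_sub, ← Real.exp_add]; simp
  have h2 : Real.exp a' - Real.exp b' = Real.exp b' * (Real.exp (a' - b') - 1) := by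
    rw [mul_sub, ← Real.exp_add]; simp
  rw [h1, h2]
  have h3 : 1 ≤ Real.exp (a - b) := Real.one_le_exp (by linarith)
  have h4 := Real.exp_le_exp.2 h
  have h5 := Real.exp_le_exp.2 hb
  exact mul_le_mul h5 (by linarith) (by linarith) (Real.exp_pos _).le

lemma exp_add_exp_sub_le {a f u : ℝ} (h : |f| ≤ |u|) :
    Real.exp (a + f) + Real.exp (a - f) ≤ Real.exp (a + u) + Real.exp (a - u) := by
  have h1 := Real.cosh_le_cosh.2 h
  rw [Real.cosh_eq, Real.cosh_eq] at h1
  simp only [sub_eq_add_neg, Real.exp_add, ← mul_add]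
  exact mul_le_mul_of_nonneg_left (by linarith) (Real.exp_pos a).le

/-- If one of `θ`, `θ'` (data `a, f, u` and `a', f', u'`) is better for both signs, using it twice
reduces the claim to monotonicity of `cosh`. Otherwise the increment from `f` to `u` at the index
with larger `u` exceeds the one at the other index and starts from a higher point, so convexity of
`exp` closes the case. -/
lemma exp_add_exp_contraction_of_nonneg {a a' f f' u u' P M : ℝ}
    (hf : |f| ≤ u) (hf' : |f'| ≤ u') (hff : |f - f'| ≤ |u - u'|)
    (h1 : a + u ≤ P) (h2 : a - u ≤ M) (h3 : a' + u' ≤ P) (h4 : a' - u' ≤ M) :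
    Real.exp (a + f) + Real.exp (a' - f') ≤ Real.exp P + Real.exp M := by
  have e1 := Real.exp_le_exp.2 h1
  have e2 := Real.exp_le_exp.2 h2
  have e3 := Real.exp_le_exp.2 h3
  have e4 := Real.exp_le_exp.2 h4
  have hfa := abs_le.1 hf
  have hfa' := abs_le.1 hf'
  rcases lt_or_ge (a + f) (a' + f') with h | h
  · have := Real.exp_le_exp.2 h.le
    have := exp_add_exp_sub_le (a := a') (hf'.trans (le_abs_self u'))
    linarith
  rcases lt_or_ge (a' - f') (a - f) with h' | h'
  · have := Real.exp_le_exp.2 h'.le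
    have := exp_add_exp_sub_le (a := a) (hf.trans (le_abs_self u))
    linarith
  rcases le_total u' u with huu | huu
  · rw [abs_of_nonneg (sub_nonneg.2 huu)] at hff
    have := abs_le.1 hff
    have := exp_sub_exp_le (a := a' - f') (b := a' - u') (a' := a + u) (b' := a + f)
      (by linarith) (by linarith) (by linarith)
    linarith
  · rw [abs_of_nonpos (sub_nonpos.2 huu)] at hff
    have := abs_le.1 hff
    have := exp_sub_exp_le (a := a + f) (b := a - u) (a' := a' + u') (b' := a' - f')
      (by linarith) (by linarith) (by linarith)
    linarith

/-- The two-point inequality behind the contraction principle for exponential moments. -/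
lemma exp_add_exp_contraction {a a' f f' u u' P M : ℝ}
    (hf : |f| ≤ |u|) (hf' : |f'| ≤ |u'|) (hff : |f - f'| ≤ |u - u'|)
    (h1 : a + u ≤ P) (h2 : a - u ≤ M) (h3 : a' + u' ≤ P) (h4 : a' - u' ≤ M) :
    Real.exp (a + f) + Real.exp (a' - f') ≤ Real.exp P + Real.exp M := by
  rcases le_total 0 u with hu | hu <;> rcases le_total 0 u' with hu' | hu'
  · rw [abs_of_nonneg hu] at hf
    rw [abs_of_nonneg hu'] at hf'
    exact exp_add_exp_contraction_of_nonneg hf hf' hff h1 h2 h3 h4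
  -- For `u`, `u'` of opposite signs the two exponentials are dominated separately, one by `P` and
  -- one by `M`.
  · rw [abs_of_nonneg hu] at hf
    rw [abs_of_nonpos hu'] at hf'
    have := abs_le.1 hf
    have := abs_le.1 hf'
    exact add_le_add (Real.exp_le_exp.2 (by linarith)) (Real.exp_le_exp.2 (by linarith))
  · rw [abs_of_nonpos hu] at hf
    rw [abs_of_nonneg hu'] at hf'
    have := abs_le.1 hf
    have := abs_le.1 hf'
    rw [add_comm (Real.exp P)]
    exact add_le_add (Real.exp_le_exp.2 (by linarith)) (Real.exp_le_exp.2 (by linarith))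
  · rw [abs_of_nonpos hu] at hf
    rw [abs_of_nonpos hu'] at hf'
    rw [add_comm (Real.exp P)]
    refine exp_add_exp_contraction_of_nonneg (u := -u) (u' := -u') hf hf' ?_ (by linarith) (by linarith)
      (by linarith) (by linarith)
    rwa [← abs_neg (-u - -u'), show -(-u - -u') = u - u' by ring]

variable {ι : Type*} [Finite ι]

lemma le_iSup_of_finite (g : ι → ℝ) (θ : ι) : g θ ≤ ⨆ θ, g θ :=
  le_ciSup (Set.finite_range g).bddAbove θ

variable [Nonempty ι]

/-- **Contraction principle** for exponential moments of Rademacher averages. -/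
theorem sum_exp_iSup_contraction {n : ℕ} (a : ι → ℝ) (f u : ι → Fin n → ℝ)
    (hf : ∀ θ j, |f θ j| ≤ |u θ j|) (hff : ∀ θ θ' j, |f θ j - f θ' j| ≤ |u θ j - u θ' j|) :
    ∑ ε : Fin n → Bool, Real.exp (⨆ θ, (a θ + ∑ j, boolSign (ε j) * f θ j)) ≤
      ∑ ε : Fin n → Bool, Real.exp (⨆ θ, (a θ + ∑ j, boolSign (ε j) * u θ j)) := by
  induction n generalizing a with
  | zero => simp
  | succ n ih =>
    rw [sum_pi_bool_succ, sum_pi_bool_succ]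
    simp only [Fin.sum_univ_succ, Fin.cons_zero, Fin.cons_succ, boolSign_true, boolSign_false,
      one_mul, neg_one_mul, ← add_assoc]
    rw [Finset.sum_add_distrib]
    have ih' := fun a => ih a (fun θ j => f θ j.succ) (fun θ j => u θ j.succ)
      (fun θ j => hf θ j.succ) (fun θ θ' j => hff θ θ' j.succ)
    refine (add_le_add (ih' fun θ => a θ + f θ 0) (ih' fun θ => a θ + -f θ 0)).trans ?_
    rw [← Finset.sum_add_distrib]
    refine Finset.sum_le_sum fun ε _ => ?_
    -- The two values of the first sign have separate maximizers `θ`, `θ'`; the two-point inequality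
    -- exchanges `f` for `u` in that coordinate.
    obtain ⟨θ, hθ⟩ := exists_eq_ciSup_of_finite
      (f := fun θ => a θ + f θ 0 + ∑ j : Fin n, boolSign (ε j) * u θ j.succ)
    obtain ⟨θ', hθ'⟩ := exists_eq_ciSup_of_finite
      (f := fun θ => a θ + -f θ 0 + ∑ j : Fin n, boolSign (ε j) * u θ j.succ)
    rw [← hθ, ← hθ']
    have hP := le_iSup_of_finite
      fun θ => a θ + u θ 0 + ∑ j : Fin n, boolSign (ε j) * u θ j.succ
    have hM := le_iSup_of_finite
      fun θ => a θ + -u θ 0 + ∑ j : Fin n, boolSign (ε j) * u θ j.succ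
    refine le_trans (le_of_eq ?_) (exp_add_exp_contraction
      (a := a θ + ∑ j : Fin n, boolSign (ε j) * u θ j.succ)
      (a' := a θ' + ∑ j : Fin n, boolSign (ε j) * u θ' j.succ) (hf θ 0) (hf θ' 0) (hff θ θ' 0)
      (le_trans (le_of_eq (by ring)) (hP θ)) (le_trans (le_of_eq (by ring)) (hM θ))
      (le_trans (le_of_eq (by ring)) (hP θ')) (le_trans (le_of_eq (by ring)) (hM θ')))
    congr 2 <;> ring

end Rademacher

/-! ### Rademacher sums in a Hilbert space -/

section Hilbert

variable {E : Type*} [NormedAddCommGroup E] [InnerProductSpace ℝ E]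

/-- Convexity of the power: `x` and `y` lie in `[Y, X]` and have the same sum as its endpoints. -/
lemma pow_add_pow_le_of_add_eq {x y X Y : ℝ} (hY : 0 ≤ Y) (h : x + y = X + Y) (hx : Y ≤ x)
    (hy : Y ≤ y) (k : ℕ) : x ^ k + y ^ k ≤ X ^ k + Y ^ k := by
  rcases eq_or_lt_of_le (show Y ≤ X by linarith) with hXY | hXY
  · obtain rfl : x = Y := by linarith
    obtain rfl : y = X := by linarith
    rw [add_comm]
  have hd : 0 < X - Y := sub_pos.2 hXY
  have key := (convexOn_pow k).2 (x := X) (y := Y) (show (0 : ℝ) ≤ X by linarith)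
    (show (0 : ℝ) ≤ Y from hY)
  have h1 := key (a := (x - Y) / (X - Y)) (b := (y - Y) / (X - Y))
    (div_nonneg (by linarith) hd.le) (div_nonneg (by linarith) hd.le)
    (by rw [← add_div, div_eq_one_iff_eq hd.ne']; linarith)
  have h2 := key (a := (y - Y) / (X - Y)) (b := (x - Y) / (X - Y))
    (div_nonneg (by linarith) hd.le) (div_nonneg (by linarith) hd.le)
    (by rw [← add_div, div_eq_one_iff_eq hd.ne']; linarith)
  simp only [smul_eq_mul] at h1 h2
  have hy' : y = X + Y - x := by linarith
  subst hy'
  rw [show (x - Y) / (X - Y) * X + (X + Y - x - Y) / (X - Y) * Y = x by field_simp; ring] at h1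
  rw [show (X + Y - x - Y) / (X - Y) * X + (x - Y) / (X - Y) * Y = X + Y - x by
    field_simp; ring] at h2
  refine (add_le_add h1 h2).trans (le_of_eq ?_)
  field_simp
  ring

/-- `cosh` is a power series in the square with nonnegative coefficients. By the parallelogram law
the squares of `‖a ± v‖` have the same sum as those of `‖a‖ ± ‖v‖` and lie between them, so the
comparison holds term by term. -/
lemma cosh_norm_add_add_cosh_norm_sub_le (a v : E) :
    Real.cosh ‖a + v‖ + Real.cosh ‖a - v‖ ≤ 2 * (Real.cosh ‖a‖ * Real.cosh ‖v‖) := by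
  have h : 2 * (Real.cosh ‖a‖ * Real.cosh ‖v‖) =
      Real.cosh (‖a‖ + ‖v‖) + Real.cosh (‖a‖ - ‖v‖) := by
    rw [Real.cosh_add, Real.cosh_sub]; ring
  rw [h]
  refine hasSum_le (fun k => ?_) ((Real.hasSum_cosh _).add (Real.hasSum_cosh _))
    ((Real.hasSum_cosh _).add (Real.hasSum_cosh _))
  rw [← add_div, ← add_div]
  simp only [pow_mul]
  refine div_le_div_of_nonneg_right (pow_add_pow_le_of_add_eq (sq_nonneg _) ?_ ?_ ?_ k)
    (by positivity)
  · have := parallelogram_law_with_norm ℝ a v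
    nlinarith
  · rw [sq_le_sq, abs_norm]
    simpa using abs_norm_sub_norm_le a (-v)
  · rw [sq_le_sq, abs_norm]
    exact abs_norm_sub_norm_le a v

/-- Exponential moments of the norm of a Rademacher sum in a Hilbert space. -/
theorem sum_cosh_norm_le {n : ℕ} (a : E) (v : Fin n → E) {ρ : ℝ} (hv : ∀ j, ‖v j‖ ≤ ρ) :
    ∑ ε : Fin n → Bool, Real.cosh ‖a + ∑ j, boolSign (ε j) • v j‖ ≤
      Real.cosh ‖a‖ * (2 * Real.cosh ρ) ^ n := by
  induction n generalizing a with
  | zero => simp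
  | succ n ih =>
    rw [sum_pi_bool_succ]
    simp only [Fin.sum_univ_succ, Fin.cons_zero, Fin.cons_succ, boolSign_true, boolSign_false,
      one_smul, neg_one_smul, ← add_assoc]
    rw [Finset.sum_add_distrib]
    have ih' := fun a => ih a (fun j => v j.succ) (fun j => hv j.succ)
    refine (add_le_add (ih' (a + v 0)) (ih' (a + -v 0))).trans ?_
    rw [← add_mul, ← sub_eq_add_neg, pow_succ', ← mul_assoc]
    refine mul_le_mul_of_nonneg_right ?_ (by positivity)
    refine (cosh_norm_add_add_cosh_norm_sub_le a (v 0)).trans ?_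
    have : Real.cosh ‖v 0‖ ≤ Real.cosh ρ :=
      Real.cosh_le_cosh.2 (by rw [abs_norm]; exact (hv 0).trans (le_abs_self ρ))
    have := mul_le_mul_of_nonneg_left this (Real.cosh_pos ‖a‖).le
    linarith

/-- Exponential moments of the supremum of a contracted linear Rademacher process. -/
theorem sum_exp_iSup_rademacher_le {ι : Type*} [Finite ι] [Nonempty ι] {n : ℕ}
    (θ : ι → E) (v : Fin n → E) (f : ι → Fin n → ℝ) {r ρ lam : ℝ} (hlam : 0 ≤ lam) (hr : 0 ≤ r)
    (hθ : ∀ k, ‖θ k‖ ≤ r) (hv : ∀ j, ‖v j‖ ≤ ρ)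
    (hf : ∀ k j, |f k j| ≤ |⟪θ k, v j⟫|)
    (hff : ∀ k k' j, |f k j - f k' j| ≤ |⟪θ k, v j⟫ - ⟪θ k', v j⟫|) :
    ∑ ε : Fin n → Bool, Real.exp (⨆ k, lam * ∑ j, boolSign (ε j) * f k j) ≤
      2 * 2 ^ n * Real.exp (n * (lam * (r * ρ)) ^ 2 / 2) := by
  have h1 := sum_exp_iSup_contraction (fun _ : ι => 0) (fun k j => lam * f k j)
    (fun k j => lam * ⟪θ k, v j⟫)
    (fun k j => by
      rw [abs_mul, abs_mul]; exact mul_le_mul_of_nonneg_left (hf k j) (abs_nonneg _))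
    (fun k k' j => by
      rw [← mul_sub, ← mul_sub, abs_mul, abs_mul]
      exact mul_le_mul_of_nonneg_left (hff k k' j) (abs_nonneg _))
  have h2 := sum_cosh_norm_le (0 : E) (fun j => (lam * r) • v j) (ρ := lam * r * ρ) (fun j => by
    rw [norm_smul, Real.norm_of_nonneg (by positivity)]
    exact mul_le_mul_of_nonneg_left (hv j) (by positivity))
  calc ∑ ε : Fin n → Bool, Real.exp (⨆ k, lam * ∑ j, boolSign (ε j) * f k j)
      = ∑ ε : Fin n → Bool, Real.exp (⨆ k, (0 + ∑ j, boolSign (ε j) * (lam * f k j))) := by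
        refine Finset.sum_congr rfl fun ε _ => ?_
        congr 2; ext k
        rw [zero_add, Finset.mul_sum]
        exact Finset.sum_congr rfl fun j _ => by ring
    _ ≤ _ := h1
    _ ≤ ∑ ε : Fin n → Bool, 2 * Real.cosh ‖0 + ∑ j, boolSign (ε j) • (lam * r) • v j‖ := by
        refine Finset.sum_le_sum fun ε _ => ?_
        have h3 : (⨆ k, (0 + ∑ j, boolSign (ε j) * (lam * ⟪θ k, v j⟫))) ≤
            ‖0 + ∑ j, boolSign (ε j) • (lam * r) • v j‖ := by
          refine ciSup_le fun k => ?_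
          have e1 : 0 + ∑ j, boolSign (ε j) * (lam * ⟪θ k, v j⟫) =
              lam * ⟪θ k, ∑ j, boolSign (ε j) • v j⟫ := by
            rw [zero_add, inner_sum, Finset.mul_sum]
            exact Finset.sum_congr rfl fun j _ => by rw [inner_smul_right]; ring
          have e2 : 0 + ∑ j, boolSign (ε j) • (lam * r) • v j =
              (lam * r) • ∑ j, boolSign (ε j) • v j := by
            rw [zero_add, Finset.smul_sum]
            exact Finset.sum_congr rfl fun j _ => smul_comm _ _ _
          rw [e1, e2, norm_smul, Real.norm_of_nonneg (by positivity), mul_assoc]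
          refine mul_le_mul_of_nonneg_left ?_ hlam
          exact (real_inner_le_norm _ _).trans
            (mul_le_mul_of_nonneg_right (hθ k) (norm_nonneg _))
        refine (Real.exp_le_exp.2 h3).trans ?_
        rw [Real.cosh_eq]
        have := Real.exp_pos (-‖0 + ∑ j, boolSign (ε j) • (lam * r) • v j‖)
        linarith
    _ ≤ 2 * (2 * Real.cosh (lam * r * ρ)) ^ n := by
        rw [← Finset.mul_sum]
        have := h2
        rw [norm_zero, Real.cosh_zero, one_mul] at this
        linarith
    _ ≤ _ := by
        rw [mul_pow, ← mul_assoc]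
        refine mul_le_mul_of_nonneg_left ?_ (by positivity)
        refine (pow_le_pow_left₀ (Real.cosh_pos _).le (Real.cosh_le_exp_half_sq _) n).trans
          (le_of_eq ?_)
        rw [← Real.exp_nat_mul]
        congr 1; ring

end Hilbert

section Sampling

/-! ### Uniform deviations under sampling with and without replacement -/

variable {ι κ : Type*} [Finite ι] [Nonempty ι] [Fintype κ]

/-- Jensen's inequality for the convex functional `exp ∘ sup`, applied to the uniform average over
`κ`. -/
lemma card_mul_exp_iSup_le [Nonempty κ] (h : ι → ℝ) (g : κ → ι → ℝ)
    (hg : ∀ θ, Fintype.card κ * h θ = ∑ k, g k θ) :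
    Fintype.card κ * Real.exp (⨆ θ, h θ) ≤ ∑ k, Real.exp (⨆ θ, g k θ) := by
  obtain ⟨θ, hθ⟩ := exists_eq_ciSup_of_finite (f := h)
  have hc : (0 : ℝ) < Fintype.card κ := by exact_mod_cast Fintype.card_pos
  have hJ := convexOn_exp.map_sum_le (t := (Finset.univ : Finset κ))
    (w := fun _ => (Fintype.card κ : ℝ)⁻¹) (p := fun k => g k θ) (fun _ _ => by positivity)
    (by simp [hc.ne']) (fun _ _ => trivial)
  simp only [smul_eq_mul, ← Finset.mul_sum] at hJ
  rw [← hg, inv_mul_cancel_left₀ hc.ne', hθ] at hJ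
  rw [← le_inv_mul_iff₀ hc]
  refine hJ.trans (mul_le_mul_of_nonneg_left ?_ (by positivity))
  exact Finset.sum_le_sum fun k _ => Real.exp_le_exp.2 (le_iSup_of_finite (g k) θ)

variable {β : Type*} [Fintype β]

/-- Separates the repetition pattern `p` of a sample from its values, so that a permutation of `β`
can move the values `e` to any other injective sample. -/
lemma exists_injective_comp_eq {b : ℕ} (hb : b ≤ Fintype.card β) (y : Fin b → β) :
    ∃ (e : Fin b → β) (p : Fin b → Fin b), Function.Injective e ∧ ∀ j, y j = e (p j) := by
  classical
  obtain ⟨t, hst, ht⟩ := Finset.exists_superset_card_eq (s := Finset.univ.image y)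
    (Finset.card_image_le.trans (by simp)) hb
  let e := t.equivFinOfCardEq ht
  refine ⟨fun j => e.symm j, fun j => e ⟨y j, hst (by simp)⟩, fun i j h => ?_, fun j => by simp⟩
  exact e.symm.injective (Subtype.ext h)

lemma sum_pi_sum_apply {b : ℕ} [Nonempty β] (g : β → ℝ) :
    ∑ z : Fin b → β, ∑ j, g (z j) = (Fintype.card β : ℝ) ^ b *
      (b * ((∑ i, g i) / Fintype.card β)) := by
  have hc : (Fintype.card β : ℝ) ≠ 0 := by exact_mod_cast Fintype.card_ne_zero
  rw [Finset.sum_comm]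
  have : ∀ j : Fin b, ∑ z : Fin b → β, g (z j) =
      (Fintype.card β : ℝ) ^ b * ((∑ i, g i) / Fintype.card β) := by
    intro j
    have h := Fintype.sum_piFinset_apply g Finset.univ j
    rw [Fintype.piFinset_univ] at h
    rw [h]
    obtain ⟨m, rfl⟩ : ∃ m, b = m + 1 := ⟨b - 1, by have := j.2; omega⟩
    simp [pow_succ]
    field_simp
  simp [this]
  ring

/-- Exchanging coordinates of two samples according to a sign pattern. -/
def swapEquiv {b : ℕ} (ε : Fin b → Bool) : (Fin b → β) × (Fin b → β) ≃ (Fin b → β) × (Fin b → β) :=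
  Function.Involutive.toPerm
    (fun q => (fun j => if ε j then q.1 j else q.2 j, fun j => if ε j then q.2 j else q.1 j))
    (fun q => by
      ext j <;> by_cases h : ε j <;> simp [h])

/-- **Symmetrization** for exponential moments of suprema of centred empirical sums. -/
theorem sum_exp_iSup_centered_le {b : ℕ} [Nonempty β] (f : ι → β → ℝ) :
    2 ^ b * ∑ z : Fin b → β, Real.exp (⨆ θ, ∑ j, (f θ (z j) - (∑ i, f θ i) / Fintype.card β)) ≤
      ∑ z : Fin b → β, ∑ ε : Fin b → Bool,
        Real.exp (⨆ θ, 2 * ∑ j, boolSign (ε j) * f θ (z j)) := by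
  have hc : (0 : ℝ) < (Fintype.card β : ℝ) ^ b := by
    have : (0 : ℝ) < Fintype.card β := by exact_mod_cast Fintype.card_pos
    positivity
  let Φ : (Fin b → Bool) → (Fin b → β) → ℝ := fun ε z =>
    Real.exp (⨆ θ, 2 * ∑ j, boolSign (ε j) * f θ (z j))
  -- The population mean is the average over an independent ghost sample `z'`; Jensen moves this
  -- average outside.
  have h1 : (Fintype.card β : ℝ) ^ b *
      ∑ z : Fin b → β, Real.exp (⨆ θ, ∑ j, (f θ (z j) - (∑ i, f θ i) / Fintype.card β)) ≤
      ∑ z : Fin b → β, ∑ z' : Fin b → β, Real.exp (⨆ θ, ∑ j, (f θ (z j) - f θ (z' j))) := by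
    rw [Finset.mul_sum]
    refine Finset.sum_le_sum fun z _ => ?_
    have := card_mul_exp_iSup_le
      (fun θ => ∑ j, (f θ (z j) - (∑ i, f θ i) / Fintype.card β))
      (fun (z' : Fin b → β) θ => ∑ j, (f θ (z j) - f θ (z' j))) (fun θ => by
        simp only [Finset.sum_sub_distrib]
        rw [sum_pi_sum_apply]
        simp
        ring)
    simpa using this
  have h2 : ∀ ε : Fin b → Bool,
      ∑ z : Fin b → β, ∑ z' : Fin b → β, Real.exp (⨆ θ, ∑ j, (f θ (z j) - f θ (z' j))) ≤
      (Fintype.card β : ℝ) ^ b * ((∑ z, Φ ε z + ∑ z, Φ (fun j => !ε j) z) / 2) := by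
    intro ε
    have e1 : ∑ z : Fin b → β, ∑ z' : Fin b → β,
        Real.exp (⨆ θ, ∑ j, (f θ (z j) - f θ (z' j))) =
        ∑ z : Fin b → β, ∑ z' : Fin b → β,
        Real.exp (⨆ θ, ∑ j, boolSign (ε j) * (f θ (z j) - f θ (z' j))) := by
      rw [← Fintype.sum_prod_type', ← Fintype.sum_prod_type', ← (swapEquiv ε).sum_comp]
      refine Finset.sum_congr rfl fun q _ => ?_
      congr 2; ext θ
      refine Finset.sum_congr rfl fun j _ => ?_
      by_cases h : ε j <;> simp [swapEquiv, Function.Involutive.toPerm, h]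
    rw [e1]
    -- The signed difference is the average of two doubled one-sample processes, the second with all
    -- signs flipped. This is the source of the factor 2.
    have e2 : ∀ z z' : Fin b → β,
        Real.exp (⨆ θ, ∑ j, boolSign (ε j) * (f θ (z j) - f θ (z' j))) ≤
        (Φ ε z + Φ (fun j => !ε j) z') / 2 := by
      intro z z'
      have := card_mul_exp_iSup_le
        (fun θ => ∑ j, boolSign (ε j) * (f θ (z j) - f θ (z' j)))
        (fun (e : Bool) θ => if e then 2 * ∑ j, boolSign (ε j) * f θ (z j)
          else 2 * ∑ j, boolSign (!ε j) * f θ (z' j)) (fun θ => by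
          simp [boolSign_not, mul_sub]
          ring)
      simp only [Fintype.sum_bool, Fintype.card_bool, Nat.cast_ofNat, if_true,
        Bool.false_eq_true, if_false] at this
      simp only [Φ]
      linarith
    refine (Finset.sum_le_sum fun z _ => Finset.sum_le_sum fun z' _ => e2 z z').trans
      (le_of_eq ?_)
    simp only [← Finset.sum_div, Finset.sum_add_distrib]
    simp [← Finset.mul_sum]
    ring
  have h3 : ∑ ε : Fin b → Bool, ∑ z, Φ (fun j => !ε j) z = ∑ ε : Fin b → Bool, ∑ z, Φ ε z :=
    (Equiv.arrowCongr (Equiv.refl (Fin b)) Equiv.boolNot).sum_comp fun ε => ∑ z, Φ ε z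
  have h4 := Finset.sum_le_sum fun (ε : Fin b → Bool) (_ : ε ∈ Finset.univ) => h1.trans (h2 ε)
  simp only [← Finset.mul_sum, ← Finset.sum_div, Finset.sum_add_distrib, h3, add_self_div_two] at h4
  rw [Finset.sum_comm]
  refine le_of_mul_le_mul_left (le_trans (le_of_eq ?_) h4) hc
  simp

variable [DecidableEq β]

/-- After averaging over all relabellings, sampling without replacement has smaller exponential
moments than any other sampling pattern. -/
lemma sum_perm_exp_iSup_le {b : ℕ} [NeZero b] {z : Fin b → β} (hz : Function.Injective z)
    (y : Fin b → β) (f : ι → β → ℝ) :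
    ∑ σ : Equiv.Perm β, Real.exp (⨆ θ, ∑ j, f θ (σ (z j))) ≤
      ∑ σ : Equiv.Perm β, Real.exp (⨆ θ, ∑ j, f θ (σ (y j))) := by
  obtain ⟨e, p, he, hy⟩ := exists_injective_comp_eq
    (by simpa using Fintype.card_le_of_injective z hz) y
  have hb : (0 : ℝ) < b := by exact_mod_cast Nat.pos_of_neZero b
  -- Addition in `Fin b` is cyclic, so for each `j` the index `p j + k` runs through all positions
  -- as `k` does. Averaging over shifts undoes the repetitions of `p`.
  have h1 : ∀ σ : Equiv.Perm β, (b : ℝ) * Real.exp (⨆ θ, ∑ j, f θ (σ (z j))) ≤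
      ∑ k : Fin b, Real.exp (⨆ θ, ∑ j, f θ (σ (z (p j + k)))) := by
    intro σ
    have := card_mul_exp_iSup_le (fun θ => ∑ j, f θ (σ (z j)))
      (fun (k : Fin b) θ => ∑ j, f θ (σ (z (p j + k)))) (fun θ => by
        rw [Finset.sum_comm]
        have : ∀ j, ∑ k, f θ (σ (z (p j + k))) = ∑ k, f θ (σ (z k)) := fun j =>
          Equiv.sum_comp (Equiv.addLeft (p j)) fun k => f θ (σ (z k))
        simp [this])
    simpa using this
  have h2 : ∀ k : Fin b, ∑ σ : Equiv.Perm β, Real.exp (⨆ θ, ∑ j, f θ (σ (z (p j + k)))) =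
      ∑ σ : Equiv.Perm β, Real.exp (⨆ θ, ∑ j, f θ (σ (y j))) := by
    intro k
    -- `τ` carries `e` to the shifted sample `z`, and is absorbed by reindexing the sum over `σ`.
    obtain ⟨τ, hτ⟩ := Equiv.Perm.exists_extending_pair e (fun j => z (j + k)) he
      (hz.comp (add_left_injective k))
    simp only [hy]
    rw [← Equiv.sum_comp (Equiv.mulRight τ)
      fun σ : Equiv.Perm β => Real.exp (⨆ θ, ∑ j, f θ (σ (e (p j))))]
    simp [hτ]
  refine le_of_mul_le_mul_left ?_ hb
  rw [Finset.mul_sum]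
  refine (Finset.sum_le_sum fun σ _ => h1 σ).trans ?_
  rw [Finset.sum_comm]
  simp [h2]

/-- **Hoeffding's comparison**: exponential moments of suprema of empirical sums under sampling
without replacement are at most those under sampling with replacement. -/
theorem sum_injective_exp_iSup_le {b : ℕ} [NeZero b] (f : ι → β → ℝ) :
    (Fintype.card β : ℝ) ^ b *
        ∑ z : Fin b → β with Function.Injective z, Real.exp (⨆ θ, ∑ j, f θ (z j)) ≤
      (Finset.univ.filter fun z : Fin b → β => Function.Injective z).card *
        ∑ y : Fin b → β, Real.exp (⨆ θ, ∑ j, f θ (y j)) := by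
  set S := Finset.univ.filter fun z : Fin b → β => Function.Injective z with hS
  have hmem : ∀ z, z ∈ S ↔ Function.Injective z := fun z => by simp [hS]
  let Ψ : (Fin b → β) → ℝ := fun z => Real.exp (⨆ θ, ∑ j, f θ (z j))
  have hP : (0 : ℝ) < Fintype.card (Equiv.Perm β) := by exact_mod_cast Fintype.card_pos
  have h1 : ∑ z ∈ S, ∑ σ : Equiv.Perm β, Ψ (fun j => σ (z j)) =
      Fintype.card (Equiv.Perm β) * ∑ z ∈ S, Ψ z := by
    rw [Finset.sum_comm]
    have : ∀ σ : Equiv.Perm β, ∑ z ∈ S, Ψ (fun j => σ (z j)) = ∑ z ∈ S, Ψ z := fun σ =>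
      Finset.sum_nbij' (fun z j => σ (z j)) (fun z j => σ.symm (z j))
        (fun z hz => hmem _ |>.2 (σ.injective.comp (hmem _ |>.1 hz)))
        (fun z hz => hmem _ |>.2 (σ.symm.injective.comp (hmem _ |>.1 hz)))
        (fun z _ => by simp) (fun z _ => by simp) (fun z _ => rfl)
    simp [this]
  have h2 : ∑ y : Fin b → β, ∑ σ : Equiv.Perm β, Ψ (fun j => σ (y j)) =
      Fintype.card (Equiv.Perm β) * ∑ y, Ψ y := by
    rw [Finset.sum_comm]
    have : ∀ σ : Equiv.Perm β, ∑ y : Fin b → β, Ψ (fun j => σ (y j)) = ∑ y, Ψ y := fun σ =>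
      (Equiv.arrowCongr (Equiv.refl (Fin b)) σ).sum_comp Ψ
    simp [this]
  have h3 : ∑ z ∈ S, ∑ _y : Fin b → β, ∑ σ : Equiv.Perm β, Ψ (fun j => σ (z j)) ≤
      ∑ _z ∈ S, ∑ y : Fin b → β, ∑ σ : Equiv.Perm β, Ψ (fun j => σ (y j)) :=
    Finset.sum_le_sum fun z hz => Finset.sum_le_sum fun y _ =>
      sum_perm_exp_iSup_le ((hmem z).1 hz) y f
  simp only [Finset.sum_const, nsmul_eq_mul, ← Finset.mul_sum, h1, h2] at h3
  refine le_of_mul_le_mul_left ?_ hP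
  have h4 : ((Finset.univ : Finset (Fin b → β)).card : ℝ) = (Fintype.card β : ℝ) ^ b := by simp
  rw [h4] at h3
  rw [mul_left_comm, mul_left_comm _ (S.card : ℝ)]
  exact h3

variable {E : Type*} [NormedAddCommGroup E] [InnerProductSpace ℝ E]

theorem sum_exp_iSup_deviation_le [Nonempty β] {b : ℕ} [NeZero b]
    (S : Finset (Fin b → β))
    (hS : S = Finset.univ ∨ ∀ z, z ∈ S ↔ Function.Injective z)
    (θ : ι → E) (v : β → E) (f : ι → β → ℝ) {r ρ lam : ℝ} (hlam : 0 ≤ lam) (hr : 0 ≤ r)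
    (hθ : ∀ k, ‖θ k‖ ≤ r) (hv : ∀ i, ‖v i‖ ≤ ρ)
    (hf : ∀ k i, |f k i| ≤ |⟪θ k, v i⟫|)
    (hff : ∀ k k' i, |f k i - f k' i| ≤ |⟪θ k, v i⟫ - ⟪θ k', v i⟫|) :
    ∑ z ∈ S, Real.exp (⨆ k, ∑ j, lam * (f k (z j) - (∑ i, f k i) / Fintype.card β)) ≤
      S.card * (2 * Real.exp (b * (2 * lam * (r * ρ)) ^ 2 / 2)) := by
  have hc : (0 : ℝ) < (Fintype.card β : ℝ) ^ b := by
    have : (0 : ℝ) < Fintype.card β := by exact_mod_cast Fintype.card_pos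
    positivity
  have h1 : (Fintype.card β : ℝ) ^ b *
      ∑ z ∈ S, Real.exp (⨆ k, ∑ j, lam * (f k (z j) - (∑ i, f k i) / Fintype.card β)) ≤
      S.card * ∑ z : Fin b → β,
        Real.exp (⨆ k, ∑ j, lam * (f k (z j) - (∑ i, f k i) / Fintype.card β)) := by
    rcases hS with rfl | hS
    · simp
    · obtain rfl : S = Finset.univ.filter fun z : Fin b → β => Function.Injective z := by
        ext z; simp [hS]
      exact sum_injective_exp_iSup_le fun k i => lam * (f k i - (∑ i, f k i) / Fintype.card β)
  have h2 := sum_exp_iSup_centered_le (b := b) fun k i => lam * f k i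
  have h3 : ∑ z : Fin b → β, ∑ ε : Fin b → Bool,
      Real.exp (⨆ k, 2 * ∑ j, boolSign (ε j) * (lam * f k (z j))) ≤
      (Fintype.card β : ℝ) ^ b * (2 * 2 ^ b * Real.exp (b * (2 * lam * (r * ρ)) ^ 2 / 2)) := by
    refine (Finset.sum_le_sum (g := fun _ => 2 * 2 ^ b *
      Real.exp (b * (2 * lam * (r * ρ)) ^ 2 / 2)) fun z _ => ?_).trans (le_of_eq ?_)
    · have := sum_exp_iSup_rademacher_le θ (fun j => v (z j)) (fun k j => f k (z j))
        (lam := 2 * lam) (by positivity) hr hθ (fun j => hv _) (fun k j => hf k _)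
        (fun k k' j => hff k k' _)
      refine le_trans (le_of_eq ?_) this
      refine Finset.sum_congr rfl fun ε _ => ?_
      congr 2; ext k
      rw [Finset.mul_sum, Finset.mul_sum]
      exact Finset.sum_congr rfl fun j _ => by ring
    · simp
  have h4 : ∑ z : Fin b → β,
      Real.exp (⨆ k, ∑ j, lam * (f k (z j) - (∑ i, f k i) / Fintype.card β)) ≤
      (Fintype.card β : ℝ) ^ b * (2 * Real.exp (b * (2 * lam * (r * ρ)) ^ 2 / 2)) := by
    refine le_of_mul_le_mul_left ?_ (show (0 : ℝ) < 2 ^ b by positivity)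
    refine le_trans (le_of_eq ?_) (h2.trans (h3.trans (le_of_eq ?_)))
    · congr 1
      refine Finset.sum_congr rfl fun z _ => ?_
      congr 2; ext k
      refine Finset.sum_congr rfl fun j _ => ?_
      rw [← Finset.mul_sum]; ring
    · ring
  refine le_of_mul_le_mul_left (h1.trans ?_) hc
  refine (mul_le_mul_of_nonneg_left h4 (by positivity)).trans (le_of_eq (by ring))

omit [Finite ι] [Nonempty ι] in
/-- Dimension-free uniform deviation inequality for contracted linear classes, under uniform
sampling with or without replacement. -/
theorem card_deviation_le [Nonempty β] {b : ℕ} [NeZero b]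
    (B S : Finset (Fin b → β)) (hBS : B ⊆ S)
    (hS : S = Finset.univ ∨ ∀ z, z ∈ S ↔ Function.Injective z)
    (θ : ι → E) (v : β → E) (f : ι → β → ℝ) {r ρ s : ℝ} (hs : 0 ≤ s) (hr : 0 < r) (hρ : 0 < ρ)
    (hθ : ∀ k, ‖θ k‖ ≤ r) (hv : ∀ i, ‖v i‖ ≤ ρ)
    (hf : ∀ k i, |f k i| ≤ |⟪θ k, v i⟫|)
    (hff : ∀ k k' i, |f k i - f k' i| ≤ |⟪θ k, v i⟫ - ⟪θ k', v i⟫|)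
    (hB : ∀ z ∈ B, ∃ k, r * ρ * s < (∑ j, f k (z j)) / b - (∑ i, f k i) / Fintype.card β) :
    (B.card : ℝ) ≤ S.card * (2 * Real.exp (-(b * s ^ 2 / 8))) := by
  rcases B.eq_empty_or_nonempty with h0 | h0
  · rw [h0]; simp; positivity
  have hb : (0 : ℝ) < b := by exact_mod_cast Nat.pos_of_neZero b
  -- One violating index per bad sample suffices, so the supremum may be taken over the finite set
  -- `B`.
  have hex : ∀ z : B, ∃ k, r * ρ * s <
    (∑ j, f k (z.1 j)) / b - (∑ i, f k i) / Fintype.card β := fun z => hB z.1 z.2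
  choose κ hκ using hex
  have : Nonempty B := h0.to_subtype
  -- The minimizer of the Chernoff exponent `2 * b * (lam * r * ρ) ^ 2 - lam * b * r * ρ * s`.
  set lam := s / (4 * (r * ρ)) with hlam
  have hlam0 : 0 ≤ lam := by positivity
  have hle := sum_exp_iSup_deviation_le S hS (fun z : B => θ (κ z)) v (fun z => f (κ z)) hlam0
    hr.le (fun k => hθ _) hv (fun k => hf _) (fun k k' => hff _ _)
  have hlow : B.card * Real.exp (b * s ^ 2 / 4) ≤ ∑ z ∈ S, Real.exp (⨆ k : B, ∑ j,
      lam * (f (κ k) (z j) - (∑ i, f (κ k) i) / Fintype.card β)) := by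
    refine le_trans ?_ (Finset.sum_le_sum_of_subset_of_nonneg hBS
      fun _ _ _ => (Real.exp_pos _).le)
    rw [← nsmul_eq_mul]
    refine Finset.card_nsmul_le_sum _ _ _ fun z hz => Real.exp_le_exp.2 ?_
    refine le_trans ?_ (le_iSup_of_finite _ ⟨z, hz⟩)
    have h := hκ ⟨z, hz⟩
    rw [← Finset.mul_sum, Finset.sum_sub_distrib]
    simp only [Finset.sum_const, Finset.card_univ, Fintype.card_fin, nsmul_eq_mul]
    have h' : b * (r * ρ * s) ≤ ∑ j, f (κ ⟨z, hz⟩) (z j) -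
        b * ((∑ i, f (κ ⟨z, hz⟩) i) / Fintype.card β) := by
      have := mul_le_mul_of_nonneg_left h.le hb.le
      rwa [mul_sub, mul_div_cancel₀ _ hb.ne'] at this
    refine le_trans (le_of_eq ?_) (mul_le_mul_of_nonneg_left h' hlam0)
    rw [hlam]; field_simp
  have he : (b : ℝ) * (2 * lam * (r * ρ)) ^ 2 / 2 = b * s ^ 2 / 8 := by
    rw [hlam]; field_simp; ring
  rw [he] at hle
  have h5 := hlow.trans hle
  rw [← le_div_iff₀ (Real.exp_pos _)] at h5
  refine h5.trans (le_of_eq ?_)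
  rw [mul_div_assoc, mul_div_assoc, ← Real.exp_sub]
  congr 3; ring

end Sampling

section BottomMean

/-! ### The variational formula for the mean of the bottom elements -/

/-- Bound each hinge below by `τ - s` on the first `k` entries and by `0` on the others; no sorting
is needed. -/
lemma mul_sub_sum_le_take_sum (L : List ℝ) (k : ℕ) (hk : k ≤ L.length) (τ : ℝ) :
    k * τ - (L.map fun s => max (τ - s) 0).sum ≤ (L.take k).sum := by
  have h1 : (L.map fun s => max (τ - s) 0).sum =
      ((L.take k).map fun s => max (τ - s) 0).sum + ((L.drop k).map fun s => max (τ - s) 0).sum := by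
    rw [← List.sum_append, ← List.map_append, List.take_append_drop]
  have h2 : 0 ≤ ((L.drop k).map fun s => max (τ - s) 0).sum :=
    List.sum_nonneg fun x hx => by
      obtain ⟨s, -, rfl⟩ := List.mem_map.1 hx
      exact le_max_right _ _
  have h3 : ∀ M : List ℝ, M.length * τ - M.sum ≤ (M.map fun s => max (τ - s) 0).sum := by
    intro M
    induction M with
    | nil => simp
    | cons a M ih =>
      simp only [List.length_cons, List.sum_cons, List.map_cons]
      push_cast
      have := le_max_left (τ - a) 0
      linarith
  have h4 := h3 (L.take k)
  rw [List.length_take, min_eq_left hk] at h4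
  linarith

/-- At the `k`-th smallest entry both hinge bounds of the preceding inequality are equalities. -/
lemma take_sum_eq_mul_sub_sum (L : List ℝ) (hL : L.Pairwise (· ≤ ·)) (k : ℕ) (hk0 : 0 < k)
    (hk : k ≤ L.length) :
    ∃ τ ∈ L, (L.take k).sum = k * τ - (L.map fun s => max (τ - s) 0).sum := by
  have hlt : k - 1 < L.length := by omega
  refine ⟨L[k - 1], List.getElem_mem hlt, ?_⟩
  set τ := L[k - 1] with hτ
  rw [List.pairwise_iff_getElem] at hL
  have h1 : (L.map fun s => max (τ - s) 0).sum =
      ((L.take k).map fun s => max (τ - s) 0).sum + ((L.drop k).map fun s => max (τ - s) 0).sum := by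
    rw [← List.sum_append, ← List.map_append, List.take_append_drop]
  have h2 : ((L.drop k).map fun s => max (τ - s) 0).sum = 0 := by
    refine List.sum_eq_zero fun x hx => ?_
    obtain ⟨s, hs, rfl⟩ := List.mem_map.1 hx
    obtain ⟨i, hi, rfl⟩ := List.mem_iff_getElem.1 hs
    rw [List.getElem_drop]
    rw [List.length_drop] at hi
    have := hL (k - 1) (k + i) hlt (by omega) (by omega)
    exact max_eq_right (by linarith)
  have h3 : ∀ M : List ℝ, (∀ s ∈ M, s ≤ τ) →
      (M.map fun s => max (τ - s) 0).sum = M.length * τ - M.sum := by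
    intro M hM
    induction M with
    | nil => simp
    | cons a M ih =>
      simp only [List.length_cons, List.sum_cons, List.map_cons]
      push_cast
      rw [ih fun s hs => hM s (List.mem_cons_of_mem _ hs),
        max_eq_left (sub_nonneg.2 (hM a List.mem_cons_self))]
      ring
  rw [h1, h2, h3 (L.take k), List.length_take, min_eq_left hk]
  · ring
  · intro s hs
    obtain ⟨i, hi, rfl⟩ := List.mem_iff_getElem.1 hs
    rw [List.getElem_take]
    rw [List.length_take] at hi
    rcases Nat.lt_or_ge i (k - 1) with h | h
    · exact hL i (k - 1) (by omega) hlt h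
    · have : i = k - 1 := by omega
      subst this; rfl

variable {c : ℝ} (hc1 : c ≤ 1) (S : Multiset ℝ)

/-- The number of elements over which `bottomMean` averages. -/
noncomputable def bottomCount (c : ℝ) (m : ℕ) : ℕ := ⌊c * (m : ℝ)⌋₊

include hc1

lemma bottomCount_le (m : ℕ) : bottomCount c m ≤ m :=
  Nat.floor_le_of_le (mul_le_of_le_one_left (Nat.cast_nonneg m) hc1)

lemma le_bottomCount_mul_bottomMean (τ : ℝ) :
    bottomCount c S.card * τ - (S.map fun s => max (τ - s) 0).sum ≤
      bottomCount c S.card * bottomMean c S := by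
  have h := mul_sub_sum_le_take_sum (S.sort (· ≤ ·)) (bottomCount c S.card)
    (by rw [Multiset.length_sort]; exact bottomCount_le hc1 _) τ
  have e : ((S.sort (· ≤ ·)).map fun s => max (τ - s) 0).sum =
      (S.map fun s => max (τ - s) 0).sum := by
    conv_rhs => rw [← Multiset.sort_eq S (· ≤ ·), Multiset.map_coe, Multiset.sum_coe]
  rw [e] at h
  refine h.trans ?_
  rcases Nat.eq_zero_or_pos (bottomCount c S.card) with h0 | h0
  · simp [h0]
  · refine le_of_eq ?_
    have h0' : (bottomCount c S.card : ℝ) ≠ 0 := by exact_mod_cast h0.ne'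
    exact (mul_div_cancel₀ _ h0').symm

lemma exists_bottomCount_mul_bottomMean_eq (hk : 0 < bottomCount c S.card) :
    ∃ τ ∈ S, bottomCount c S.card * bottomMean c S =
      bottomCount c S.card * τ - (S.map fun s => max (τ - s) 0).sum := by
  obtain ⟨τ, hτ, h⟩ := take_sum_eq_mul_sub_sum (S.sort (· ≤ ·)) (S.pairwise_sort (· ≤ ·))
    (bottomCount c S.card) hk (by rw [Multiset.length_sort]; exact bottomCount_le hc1 _)
  have e : ((S.sort (· ≤ ·)).map fun s => max (τ - s) 0).sum =
      (S.map fun s => max (τ - s) 0).sum := by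
    conv_rhs => rw [← Multiset.sort_eq S (· ≤ ·), Multiset.map_coe, Multiset.sum_coe]
  rw [e] at h
  refine ⟨τ, (Multiset.mem_sort _).1 hτ, ?_⟩
  rw [← h]
  have h0' : (bottomCount c S.card : ℝ) ≠ 0 := by exact_mod_cast hk.ne'
  exact mul_div_cancel₀ _ h0'

omit hc1 in
lemma bottomMean_eq_zero (hk : bottomCount c S.card = 0) : bottomMean c S = 0 := by
  rw [bottomMean]
  rw [bottomCount] at hk
  simp [hk]

lemma abs_bottomMean_le {B : ℝ} (hB : 0 ≤ B) (hS : ∀ s ∈ S, |s| ≤ B) : |bottomMean c S| ≤ B := by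
  rcases Nat.eq_zero_or_pos (bottomCount c S.card) with h0 | h0
  · rw [bottomMean_eq_zero S h0]; simpa
  have h0' : (0 : ℝ) < bottomCount c S.card := by exact_mod_cast h0
  refine abs_le.2 ⟨?_, ?_⟩
  · have h := le_bottomCount_mul_bottomMean hc1 S (-B)
    have : (S.map fun s => max (-B - s) 0).sum = 0 := by
      refine Multiset.sum_eq_zero fun x hx => ?_
      obtain ⟨s, hs, rfl⟩ := Multiset.mem_map.1 hx
      exact max_eq_right (by have := abs_le.1 (hS s hs); linarith)
    rw [this, sub_zero] at h
    exact le_of_mul_le_mul_left h h0'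
  · obtain ⟨τ, hτ, h⟩ := exists_bottomCount_mul_bottomMean_eq hc1 S h0
    have : 0 ≤ (S.map fun s => max (τ - s) 0).sum := by
      refine Multiset.sum_nonneg fun x hx => ?_
      obtain ⟨s, hs, rfl⟩ := Multiset.mem_map.1 hx
      exact le_max_right _ _
    have h1 : bottomMean c S ≤ τ := le_of_mul_le_mul_left (by linarith) h0'
    exact h1.trans ((le_abs_self τ).trans (hS τ hτ))

end BottomMean

/-! ### Concavity and Lipschitz continuity of the bottom mean in the model -/

section Scores

variable {c : ℝ} (hc1 : c ≤ 1) {d n : ℕ} (x : Fin n → EuclideanSpace ℝ (Fin d))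
  (A : Finset (Fin n))

@[simp] lemma card_scores (w : EuclideanSpace ℝ (Fin d)) : (scores x A w).card = A.card := by
  simp [scores]

lemma sum_map_scores (w : EuclideanSpace ℝ (Fin d)) (g : ℝ → ℝ) :
    ((scores x A w).map g).sum = ∑ i ∈ A, g ⟪w, x i⟫ := by
  simp [scores]

lemma abs_inner_le_mul {R C : ℝ} {w u : EuclideanSpace ℝ (Fin d)} (hw : ‖w‖ ≤ C) (hu : ‖u‖ ≤ R) :
    |⟪w, u⟫| ≤ C * R :=
  (abs_real_inner_le_norm w u).trans
    (mul_le_mul hw hu (norm_nonneg _) ((norm_nonneg _).trans hw))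

variable {x} {R : ℝ} (hx : ∀ i, ‖x i‖ ≤ R)

include hx in
lemma abs_le_of_mem_scores {C : ℝ} {w : EuclideanSpace ℝ (Fin d)} (hw : ‖w‖ ≤ C) {s : ℝ}
    (hs : s ∈ scores x A w) : |s| ≤ C * R := by
  obtain ⟨i, -, rfl⟩ := Multiset.mem_map.1 hs
  exact abs_inner_le_mul hw (hx i)

variable (x) in
include hc1 in
/-- The bottom mean of the scores is a concave function of the linear model. -/
lemma concaveOn_bottomMean_scores :
    ConcaveOn ℝ Set.univ fun w => bottomMean c (scores x A w) := by
  refine ⟨convex_univ, fun w₁ _ w₂ _ a b ha hb hab => ?_⟩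
  rcases Nat.eq_zero_or_pos (bottomCount c A.card) with h0 | h0
  · have : ∀ w, bottomMean c (scores x A w) = 0 := fun w =>
      bottomMean_eq_zero _ (by rw [card_scores, h0])
    simp [this]
  have h0' : (0 : ℝ) < bottomCount c A.card := by exact_mod_cast h0
  obtain ⟨τ₁, -, h₁⟩ := exists_bottomCount_mul_bottomMean_eq hc1 (scores x A w₁) (by simpa)
  obtain ⟨τ₂, -, h₂⟩ := exists_bottomCount_mul_bottomMean_eq hc1 (scores x A w₂) (by simpa)
  -- The variational objective is jointly concave in model and threshold, so the mixed threshold is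
  -- a good enough competitor.
  have h := le_bottomCount_mul_bottomMean hc1 (scores x A (a • w₁ + b • w₂)) (a * τ₁ + b * τ₂)
  rw [card_scores, sum_map_scores] at h h₁ h₂
  refine le_of_mul_le_mul_left (le_trans ?_ h) h0'
  have : ∑ i ∈ A, max (a * τ₁ + b * τ₂ - ⟪a • w₁ + b • w₂, x i⟫) 0 ≤
      a * ∑ i ∈ A, max (τ₁ - ⟪w₁, x i⟫) 0 + b * ∑ i ∈ A, max (τ₂ - ⟪w₂, x i⟫) 0 := by
    rw [Finset.mul_sum, Finset.mul_sum, ← Finset.sum_add_distrib]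
    refine Finset.sum_le_sum fun i _ => ?_
    rw [inner_add_left, real_inner_smul_left, real_inner_smul_left]
    have m1 := mul_le_mul_of_nonneg_left (le_max_left (τ₁ - ⟪w₁, x i⟫) 0) ha
    have m2 := mul_le_mul_of_nonneg_left (le_max_left (τ₂ - ⟪w₂, x i⟫) 0) hb
    have m3 := mul_nonneg ha (le_max_right (τ₁ - ⟪w₁, x i⟫) 0)
    have m4 := mul_nonneg hb (le_max_right (τ₂ - ⟪w₂, x i⟫) 0)
    exact max_le (by linarith) (by linarith)
  simp only [smul_eq_mul]
  rw [mul_add, mul_left_comm, mul_left_comm _ b, h₁, h₂]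
  linarith

-- Lowering the optimal threshold of `w₁` by `R * ‖w₁ - w₂‖` gives a competitor for `w₂` whose hinge
-- terms are no larger.
include hc1 hx in
lemma bottomMean_scores_sub_le (hR : 0 ≤ R) (w₁ w₂ : EuclideanSpace ℝ (Fin d)) :
    bottomMean c (scores x A w₁) - bottomMean c (scores x A w₂) ≤ R * ‖w₁ - w₂‖ := by
  rcases Nat.eq_zero_or_pos (bottomCount c A.card) with h0 | h0
  · have : ∀ w, bottomMean c (scores x A w) = 0 := fun w =>
      bottomMean_eq_zero _ (by rw [card_scores, h0])
    rw [this, this, sub_zero]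
    positivity
  have h0' : (0 : ℝ) < bottomCount c A.card := by exact_mod_cast h0
  obtain ⟨τ, -, h₁⟩ := exists_bottomCount_mul_bottomMean_eq hc1 (scores x A w₁) (by simpa)
  have h := le_bottomCount_mul_bottomMean hc1 (scores x A w₂) (τ - R * ‖w₁ - w₂‖)
  rw [card_scores, sum_map_scores] at h h₁
  have : ∑ i ∈ A, max (τ - R * ‖w₁ - w₂‖ - ⟪w₂, x i⟫) 0 ≤ ∑ i ∈ A, max (τ - ⟪w₁, x i⟫) 0 := by
    refine Finset.sum_le_sum fun i _ => max_le_max ?_ le_rfl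
    have := abs_le.1 (abs_inner_le_mul (le_refl ‖w₁ - w₂‖) (hx i))
    rw [inner_sub_left] at this
    linarith
  refine le_of_mul_le_mul_left ?_ h0'
  rw [mul_sub] at h ⊢
  linarith

end Scores

section Loss

/-! ### Convexity, boundedness and Lipschitz continuity of the quantile loss -/

variable {l : ℝ → ℝ} {c : ℝ} {d n : ℕ} {x : Fin n → EuclideanSpace ℝ (Fin d)} {y : Fin n → ℝ}

lemma one_sub_nonneg_of_label {t : ℝ} (h : t = -1 ∨ t = 1) : 0 ≤ 1 - t := by
  rcases h with rfl | rfl <;> norm_num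

lemma one_sub_le_two_of_label {t : ℝ} (h : t = -1 ∨ t = 1) : 1 - t ≤ 2 := by
  rcases h with rfl | rfl <;> norm_num

lemma sum_div_le_of_forall_le {f : Fin n → ℝ} {K : ℝ} (hK : 0 ≤ K) (h : ∀ i, f i ≤ K) :
    (∑ i, f i) / n ≤ K := by
  refine div_le_of_le_mul₀ (Nat.cast_nonneg n) hK ?_
  refine (Finset.sum_le_sum fun i _ => h i).trans (le_of_eq ?_)
  simp [mul_comm]

lemma abs_sub_le_mul_of_lipschitzWith {Λ : ℝ≥0} (hl : LipschitzWith Λ l) (s t : ℝ) :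
    |l s - l t| ≤ Λ * |s - t| := by
  simpa [Real.dist_eq] using hl.dist_le_mul s t

/-- A linear score minus a concave quantile is convex; a monotone convex `l` and the weights `1 - y
i ≥ 0` preserve this. -/
lemma convexOn_quantileLoss (hl_convex : ConvexOn ℝ Set.univ l) (hl_mono : Monotone l)
    (hc1 : c ≤ 1) (hy : ∀ i, y i = -1 ∨ y i = 1) (A : Finset (Fin n)) :
    ConvexOn ℝ Set.univ (quantileLoss l c x y A) := by
  refine ⟨convex_univ, fun w₁ _ w₂ _ a b ha hb hab => ?_⟩
  have hq := (concaveOn_bottomMean_scores hc1 x A).2 (Set.mem_univ w₁) (Set.mem_univ w₂) ha hb hab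
  simp only [quantileLoss, smul_eq_mul] at hq ⊢
  rw [← mul_div_assoc, ← mul_div_assoc, ← add_div]
  refine div_le_div_of_nonneg_right ?_ (Nat.cast_nonneg n)
  rw [Finset.mul_sum, Finset.mul_sum, ← Finset.sum_add_distrib]
  refine Finset.sum_le_sum fun i _ => ?_
  have h1 := hl_mono (a := ⟪a • w₁ + b • w₂, x i⟫ - bottomMean c (scores x A (a • w₁ + b • w₂)))
    (b := a * (⟪w₁, x i⟫ - bottomMean c (scores x A w₁)) +
      b * (⟪w₂, x i⟫ - bottomMean c (scores x A w₂))) (by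
        rw [inner_add_left, real_inner_smul_left, real_inner_smul_left]; linarith)
  have h2 := hl_convex.2 (Set.mem_univ (⟪w₁, x i⟫ - bottomMean c (scores x A w₁)))
    (Set.mem_univ (⟪w₂, x i⟫ - bottomMean c (scores x A w₂))) ha hb hab
  simp only [smul_eq_mul] at h2
  refine (mul_le_mul_of_nonneg_left (h1.trans h2) (one_sub_nonneg_of_label (hy i))).trans
    (le_of_eq (by ring))

lemma quantileLoss_sub_le {Λ : ℝ≥0} (hl : LipschitzWith Λ l) (hc1 : c ≤ 1)
    (hy : ∀ i, y i = -1 ∨ y i = 1) (A : Finset (Fin n)) {R : ℝ} (hR : 0 ≤ R)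
    (hx : ∀ i, ‖x i‖ ≤ R) (w₁ w₂ : EuclideanSpace ℝ (Fin d)) :
    quantileLoss l c x y A w₁ - quantileLoss l c x y A w₂ ≤ 4 * Λ * R * ‖w₁ - w₂‖ := by
  simp only [quantileLoss]
  rw [← sub_div, ← Finset.sum_sub_distrib]
  refine sum_div_le_of_forall_le (by positivity) fun i => ?_
  rw [← mul_sub]
  have h1 := (le_abs_self _).trans (abs_sub_le_mul_of_lipschitzWith hl
    (⟪w₁, x i⟫ - bottomMean c (scores x A w₁)) (⟪w₂, x i⟫ - bottomMean c (scores x A w₂)))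
  have h2 : |(⟪w₁, x i⟫ - bottomMean c (scores x A w₁)) -
      (⟪w₂, x i⟫ - bottomMean c (scores x A w₂))| ≤ 2 * (R * ‖w₁ - w₂‖) := by
    have e1 := abs_le.1 (abs_inner_le_mul (le_refl ‖w₁ - w₂‖) (hx i))
    rw [inner_sub_left] at e1
    have e2 := bottomMean_scores_sub_le hc1 A hx hR w₁ w₂
    have e3 := bottomMean_scores_sub_le hc1 A hx hR w₂ w₁
    rw [norm_sub_rev] at e3
    exact abs_le.2 ⟨by linarith, by linarith⟩
  have h3 := h1.trans (mul_le_mul_of_nonneg_left h2 Λ.2)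
  have h4 : (0 : ℝ) ≤ Λ * (2 * (R * ‖w₁ - w₂‖)) := by positivity
  calc _ ≤ (1 - y i) * (Λ * (2 * (R * ‖w₁ - w₂‖))) :=
        mul_le_mul_of_nonneg_left h3 (one_sub_nonneg_of_label (hy i))
    _ ≤ 2 * (Λ * (2 * (R * ‖w₁ - w₂‖))) :=
        mul_le_mul_of_nonneg_right (one_sub_le_two_of_label (hy i)) h4
    _ = _ := by ring

lemma abs_quantileLoss_le {Λ : ℝ≥0} (hl : LipschitzWith Λ l) (hc1 : c ≤ 1)
    (hy : ∀ i, y i = -1 ∨ y i = 1) (A : Finset (Fin n)) {R C : ℝ} (hR : 0 ≤ R) (hC : 0 ≤ C)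
    (hx : ∀ i, ‖x i‖ ≤ R) {w : EuclideanSpace ℝ (Fin d)} (hw : ‖w‖ ≤ C) :
    |quantileLoss l c x y A w| ≤ 2 * (|l 0| + Λ * (2 * (C * R))) := by
  have hK : 0 ≤ 2 * (|l 0| + Λ * (2 * (C * R))) := by positivity
  have h : ∀ i, |(1 - y i) * l (⟪w, x i⟫ - bottomMean c (scores x A w))| ≤
      2 * (|l 0| + Λ * (2 * (C * R))) := by
    intro i
    rw [abs_mul, abs_of_nonneg (one_sub_nonneg_of_label (hy i))]
    refine mul_le_mul (one_sub_le_two_of_label (hy i)) ?_ (abs_nonneg _) (by norm_num)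
    have h1 := abs_sub_le_mul_of_lipschitzWith hl (⟪w, x i⟫ - bottomMean c (scores x A w)) 0
    have h2 : |⟪w, x i⟫ - bottomMean c (scores x A w) - 0| ≤ 2 * (C * R) := by
      have e1 := abs_le.1 (abs_inner_le_mul hw (hx i))
      have e2 := abs_le.1 (abs_bottomMean_le hc1 (scores x A w) (by positivity)
        fun s hs => abs_le_of_mem_scores A hx hw hs)
      exact abs_le.2 ⟨by linarith, by linarith⟩
    have h3 := h1.trans (mul_le_mul_of_nonneg_left h2 Λ.2)
    have h4 := abs_sub_abs_le_abs_sub (l (⟪w, x i⟫ - bottomMean c (scores x A w))) (l 0)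
    linarith
  rw [quantileLoss, abs_div, Nat.abs_cast]
  refine le_trans ?_ (sum_div_le_of_forall_le hK h)
  exact div_le_div_of_nonneg_right (Finset.abs_sum_le_sum_abs _ _) (Nat.cast_nonneg n)

end Loss

section Descent

/-! ### Projected subgradient descent with varying objectives -/

variable {d : ℕ} {C : ℝ}

lemma norm_projBall_le (hC : 0 ≤ C) (v : EuclideanSpace ℝ (Fin d)) : ‖projBall C v‖ ≤ C := by
  rw [projBall]
  split_ifs with h
  · exact h
  · have : 0 < ‖v‖ := hC.trans_lt (not_le.1 h)
    rw [norm_smul, Real.norm_of_nonneg (by positivity), div_mul_cancel₀ _ this.ne']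

lemma norm_projBall_sub_le (hC : 0 ≤ C) (u : EuclideanSpace ℝ (Fin d))
    {v : EuclideanSpace ℝ (Fin d)} (hv : ‖v‖ ≤ C) : ‖projBall C u - v‖ ≤ ‖u - v‖ := by
  rw [projBall]
  split_ifs with h
  · exact le_rfl
  have h' : C < ‖u‖ := not_le.1 h
  have hu : 0 < ‖u‖ := hC.trans_lt h'
  rw [← sq_le_sq₀ (norm_nonneg _) (norm_nonneg _), norm_sub_sq_real, norm_sub_sq_real, norm_smul,
    Real.norm_of_nonneg (by positivity), div_mul_cancel₀ _ hu.ne', real_inner_smul_left]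
  have h1 : ⟪u, v⟫ ≤ ‖u‖ * C :=
    (real_inner_le_norm u v).trans (mul_le_mul_of_nonneg_left hv hu.le)
  have h2 : C / ‖u‖ ≤ 1 := (div_le_one hu).2 h'.le
  have h3 := mul_le_mul_of_nonneg_left h1 (sub_nonneg.2 h2)
  have h4 : (1 - C / ‖u‖) * (‖u‖ * C) = ‖u‖ * C - C ^ 2 := by field_simp
  nlinarith [sq_nonneg (‖u‖ - C)]

/-- Testing the subgradient inequality at `w + g` gives `‖g‖ ^ 2 ≤ G * ‖g‖`. -/
lemma IsSubgradientAt.norm_le {F : EuclideanSpace ℝ (Fin d) → ℝ} {w g : EuclideanSpace ℝ (Fin d)}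
    (h : IsSubgradientAt F w g) {G : ℝ} (hF : ∀ u v, F u - F v ≤ G * ‖u - v‖) (hG : 0 ≤ G) :
    ‖g‖ ≤ G := by
  have h1 := h (w + g)
  have h2 := hF (w + g) w
  rw [add_sub_cancel_left, real_inner_self_eq_norm_sq] at h1
  rw [add_sub_cancel_left] at h2
  by_contra! hlt
  have : 0 < ‖g‖ := hG.trans_lt hlt
  nlinarith

variable {F : ℕ → EuclideanSpace ℝ (Fin d) → ℝ} {γ : ℝ} {T : ℕ} {w : ℕ → EuclideanSpace ℝ (Fin d)}

lemma IsSGDRun.norm_le (h : IsSGDRun F C γ T w) (hC : 0 ≤ C) {t : ℕ} (ht : t ≤ T) : ‖w t‖ ≤ C := by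
  cases t with
  | zero => exact h.1
  | succ t =>
    obtain ⟨g, -, hg⟩ := h.2 t ht
    rw [hg]
    exact norm_projBall_le hC _

lemma norm_averageIterate_le (hC : 0 ≤ C) (h : ∀ t < T, ‖w t‖ ≤ C) : ‖averageIterate T w‖ ≤ C := by
  rw [averageIterate, norm_smul, Real.norm_of_nonneg (by positivity)]
  have h1 : ‖∑ t ∈ Finset.range T, w t‖ ≤ T * C := by
    refine (norm_sum_le _ _).trans
      ((Finset.sum_le_sum fun t ht => h t (Finset.mem_range.1 ht)).trans ?_)
    simp
  rcases Nat.eq_zero_or_pos T with rfl | hT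
  · simpa
  · have : (0 : ℝ) < T := by exact_mod_cast hT
    rw [inv_mul_le_iff₀ this]
    exact h1

/-- Regret bound for projected subgradient descent with objectives `F 0, F 1, …`. -/
theorem IsSGDRun.sum_sub_le (h : IsSGDRun F C γ T w) (hC : 0 ≤ C) (hγ : 0 < γ) {G : ℝ} (hG : 0 ≤ G)
    (hF : ∀ t < T, ∀ u v, F t u - F t v ≤ G * ‖u - v‖) {v : EuclideanSpace ℝ (Fin d)}
    (hv : ‖v‖ ≤ C) :
    ∑ t ∈ Finset.range T, (F t (w t) - F t v) ≤ 2 * C ^ 2 / γ + T * (γ * G ^ 2 / 2) := by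
  have step : ∀ t < T, 2 * γ * (F t (w t) - F t v) ≤
      ‖w t - v‖ ^ 2 - ‖w (t + 1) - v‖ ^ 2 + γ ^ 2 * G ^ 2 := by
    intro t ht
    obtain ⟨g, hg, hw⟩ := h.2 t ht
    have h1 : ‖w (t + 1) - v‖ ^ 2 ≤ ‖w t - γ • g - v‖ ^ 2 := by
      rw [hw]
      exact pow_le_pow_left₀ (norm_nonneg _) (norm_projBall_sub_le hC _ hv) 2
    have h2 : ‖w t - γ • g - v‖ ^ 2 =
        ‖w t - v‖ ^ 2 - 2 * γ * ⟪g, w t - v⟫ + γ ^ 2 * ‖g‖ ^ 2 := by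
      rw [show w t - γ • g - v = (w t - v) - γ • g by abel, norm_sub_sq_real, norm_smul,
        real_inner_smul_right, real_inner_comm, Real.norm_of_nonneg hγ.le]
      ring
    have h3 := hg v
    rw [← neg_sub (w t) v, inner_neg_right] at h3
    have h4 : γ ^ 2 * ‖g‖ ^ 2 ≤ γ ^ 2 * G ^ 2 :=
      mul_le_mul_of_nonneg_left (pow_le_pow_left₀ (norm_nonneg _) (hg.norm_le (hF t ht) hG) 2)
        (sq_nonneg γ)
    have h5 := mul_le_mul_of_nonneg_left h3 (show 0 ≤ 2 * γ by positivity)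
    linarith
  have hsum := Finset.sum_le_sum fun t ht => step t (Finset.mem_range.1 ht)
  rw [← Finset.mul_sum, Finset.sum_add_distrib, Finset.sum_range_sub'
    (fun t => ‖w t - v‖ ^ 2)] at hsum
  simp only [Finset.sum_const, Finset.card_range, nsmul_eq_mul] at hsum
  have h0 : ‖w 0 - v‖ ^ 2 ≤ (2 * C) ^ 2 := by
    refine pow_le_pow_left₀ (norm_nonneg _) ?_ 2
    have := norm_sub_le (w 0) v
    have := h.1
    linarith
  have hT := sq_nonneg ‖w T - v‖
  refine le_of_mul_le_mul_left ?_ (show 0 < 2 * γ by positivity)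
  have e : 2 * γ * (2 * C ^ 2 / γ + T * (γ * G ^ 2 / 2)) = (2 * C) ^ 2 + T * (γ ^ 2 * G ^ 2) := by
    field_simp
  rw [e]
  linarith

end Descent

section Deviation

/-! ### Uniform deviation of the minibatch loss from the full loss -/

/-- The deviation of the mean of `f` over the sample `z` from the mean over the population. -/
noncomputable def sampleDeviation {N b : ℕ} (f : Fin N → ℝ) (z : Fin b → Fin N) : ℝ :=
  (∑ j, f (z j)) / b - (∑ i, f i) / N

lemma sampleDeviation_add {N b : ℕ} (f g : Fin N → ℝ) (z : Fin b → Fin N) :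
    sampleDeviation (fun i => f i + g i) z = sampleDeviation f z + sampleDeviation g z := by
  simp only [sampleDeviation, Finset.sum_add_distrib]
  ring

variable {N b : ℕ} [NeZero N] [NeZero b]

/-- `S` consists of all samples, or of all samples without repetition. -/
def IsSamplingScheme (S : Finset (Fin b → Fin N)) : Prop :=
  S = Finset.univ ∨ ∀ z, z ∈ S ↔ Function.Injective z

variable {B S : Finset (Fin b → Fin N)} (hBS : B ⊆ S) (hS : IsSamplingScheme S) {s : ℝ} (hs : 0 ≤ s)

include hBS hS hs

lemma card_abs_deviation_le {ι E : Type*} [NormedAddCommGroup E] [InnerProductSpace ℝ E]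
    (θ : ι → E) (v : Fin N → E) (f : ι → Fin N → ℝ) {r ρ : ℝ} (hr : 0 < r) (hρ : 0 < ρ)
    (hθ : ∀ k, ‖θ k‖ ≤ r) (hv : ∀ i, ‖v i‖ ≤ ρ) (hf : ∀ k i, |f k i| ≤ |⟪θ k, v i⟫|)
    (hff : ∀ k k' i, |f k i - f k' i| ≤ |⟪θ k, v i⟫ - ⟪θ k', v i⟫|)
    (hB : ∀ z ∈ B, ∃ k, r * ρ * s < |sampleDeviation (f k) z|) :
    (B.card : ℝ) ≤ S.card * (4 * Real.exp (-(b * s ^ 2 / 8))) := by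
  classical
  set B₁ := B.filter fun z => ∃ k, r * ρ * s < sampleDeviation (f k) z
  set B₂ := B.filter fun z => ∃ k, r * ρ * s < -sampleDeviation (f k) z
  have hsub : B ⊆ B₁ ∪ B₂ := fun z hz => by
    obtain ⟨k, hk⟩ := hB z hz
    rcases lt_abs.1 hk with h | h
    · exact Finset.mem_union_left _ (Finset.mem_filter.2 ⟨hz, k, h⟩)
    · exact Finset.mem_union_right _ (Finset.mem_filter.2 ⟨hz, k, h⟩)
  have h1 := card_deviation_le B₁ S ((Finset.filter_subset _ _).trans hBS) hS θ v f hs hr hρ hθ hv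
    hf hff (fun z hz => by simpa [sampleDeviation] using (Finset.mem_filter.1 hz).2)
  have h2 := card_deviation_le B₂ S ((Finset.filter_subset _ _).trans hBS) hS θ v
    (fun k i => -f k i) hs hr hρ hθ hv (fun k i => by rw [abs_neg]; exact hf k i)
    (fun k k' i => by rw [neg_sub_neg, abs_sub_comm]; exact hff k k' i)
    (fun z hz => by
      obtain ⟨k, hk⟩ := (Finset.mem_filter.1 hz).2
      refine ⟨k, hk.trans_le (le_of_eq ?_)⟩
      simp [sampleDeviation]
      ring)
  have h3 : (B.card : ℝ) ≤ B₁.card + B₂.card := by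
    exact_mod_cast (Finset.card_le_card hsub).trans (Finset.card_union_le _ _)
  linarith

lemma card_scalar_deviation_le (f : Fin N → ℝ) {r ρ t : ℝ} (hr : 0 < r) (hρ : 0 < ρ) (ht : |t| ≤ r)
    (hf : ∀ i, |f i| ≤ ρ) (hB : ∀ z ∈ B, r * ρ * s < |sampleDeviation (fun i => f i * t) z|) :
    (B.card : ℝ) ≤ S.card * (4 * Real.exp (-(b * s ^ 2 / 8))) :=
  card_abs_deviation_le hBS hS hs (fun _ : Unit => t) f (fun _ i => f i * t) hr hρ (fun _ => ht) hf
    (fun _ i => by simp) (fun _ _ i => by simp) (fun z hz => ⟨(), hB z hz⟩)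

/-- The offset becomes one more coordinate: `(w, a / R)` and `(K • x i, -(K * R))` have inner
product `K * (⟪w, x i⟫ - a)`. The scaling by `R` balances the coordinates, and the norms are at most
`2 * C` and `2 * K * R`. -/
lemma card_affine_deviation_le {d : ℕ} {x : Fin N → EuclideanSpace ℝ (Fin d)} {R C K : ℝ}
    (hR : 0 < R) (hC : 0 < C) (hK : 0 < K) (hx : ∀ i, ‖x i‖ ≤ R) (g : Fin N → ℝ → ℝ)
    (hg0 : ∀ i, g i 0 = 0) (hg : ∀ i u u', |g i u - g i u'| ≤ K * |u - u'|)
    (hB : ∀ z ∈ B, ∃ (w : EuclideanSpace ℝ (Fin d)) (a : ℝ), ‖w‖ ≤ C ∧ |a| ≤ C * R ∧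
      4 * K * (C * R) * s < |sampleDeviation (fun i => g i (⟪w, x i⟫ - a)) z|) :
    (B.card : ℝ) ≤ S.card * (4 * Real.exp (-(b * s ^ 2 / 8))) := by
  let ι := {p : EuclideanSpace ℝ (Fin d) × ℝ // ‖p.1‖ ≤ C ∧ |p.2| ≤ C * R}
  let θ : ι → WithLp 2 (EuclideanSpace ℝ (Fin d) × ℝ) := fun p => WithLp.toLp 2 (p.1.1, p.1.2 / R)
  let v : Fin N → WithLp 2 (EuclideanSpace ℝ (Fin d) × ℝ) := fun i => WithLp.toLp 2 (K • x i, -(K * R))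
  have hin : ∀ p i, ⟪θ p, v i⟫ = K * (⟪p.1.1, x i⟫ - p.1.2) := by
    intro p i
    rw [WithLp.prod_inner_apply]
    simp only [θ, v, real_inner_smul_right, RCLike.inner_apply, conj_trivial]
    field_simp
    ring
  refine card_abs_deviation_le hBS hS hs θ v (fun p i => g i (⟪p.1.1, x i⟫ - p.1.2))
    (r := 2 * C) (ρ := 2 * (K * R)) (by positivity) (by positivity) ?_ ?_ ?_ ?_ ?_
  · intro p
    rw [← sq_le_sq₀ (norm_nonneg _) (by positivity), WithLp.prod_norm_sq_eq_of_L2]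
    have h1 : ‖(θ p).fst‖ ≤ C := p.2.1
    have h2 : ‖(θ p).snd‖ ≤ C := by
      change |p.1.2 / R| ≤ C
      rw [abs_div, abs_of_pos hR, div_le_iff₀ hR]
      exact p.2.2
    have := pow_le_pow_left₀ (norm_nonneg _) h1 2
    have := pow_le_pow_left₀ (norm_nonneg _) h2 2
    nlinarith
  · intro i
    rw [← sq_le_sq₀ (norm_nonneg _) (by positivity), WithLp.prod_norm_sq_eq_of_L2]
    have h1 : ‖(v i).fst‖ ≤ K * R := by
      change ‖K • x i‖ ≤ K * R
      rw [norm_smul, Real.norm_of_nonneg hK.le]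
      exact mul_le_mul_of_nonneg_left (hx i) hK.le
    have h2 : ‖(v i).snd‖ ≤ K * R := by
      change |-(K * R)| ≤ K * R
      rw [abs_neg, abs_of_pos (by positivity)]
    have := pow_le_pow_left₀ (norm_nonneg _) h1 2
    have := pow_le_pow_left₀ (norm_nonneg _) h2 2
    nlinarith [sq_nonneg (K * R)]
  · intro p i
    have := hg i (⟪p.1.1, x i⟫ - p.1.2) 0
    rw [hg0, sub_zero, sub_zero] at this
    rwa [hin, abs_mul, abs_of_pos hK]
  · intro p p' i
    rw [hin, hin, ← mul_sub, abs_mul, abs_of_pos hK]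
    exact hg i _ _
  · intro z hz
    obtain ⟨w, a, hw, ha, h⟩ := hB z hz
    exact ⟨⟨(w, a), hw, ha⟩, lt_of_eq_of_lt (by ring) h⟩

end Deviation

section Stability

/-! ### Stability of the bottom mean and of the quantile loss -/

/-- Stability of the maximal value of `τ - H τ / p` in `H` and `p`. -/
lemma mul_abs_sub_le_of_variational {p p' q q' B ε : ℝ} {H H' : ℝ → ℝ} (hp : 0 ≤ p) (hp' : 0 ≤ p')
    (hq' : |q'| ≤ B) (hqq : |q - q'| ≤ 2 * B) (hε : 0 ≤ ε)
    (h1 : ∀ τ, p * τ - H τ ≤ p * q) (h1' : ∀ τ, p' * τ - H' τ ≤ p' * q')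
    (h2 : 0 < p → ∃ τ, |τ| ≤ B ∧ p * q = p * τ - H τ)
    (h2' : 0 < p' → ∃ τ, |τ| ≤ B ∧ p' * q' = p' * τ - H' τ)
    (hH : ∀ τ, |τ| ≤ B → |H' τ - H τ| ≤ ε) :
    p * |q - q'| ≤ ε + 2 * B * |p - p'| := by
  have hB : 0 ≤ B := (abs_nonneg _).trans hq'
  have hb : ∀ {e τ : ℝ}, |τ| ≤ B → |e| = |p - p'| → e * (τ - q') ≤ 2 * B * |p - p'| := by
    intro e τ hτ he
    refine (le_abs_self _).trans ?_
    rw [abs_mul, he, mul_comm]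
    refine mul_le_mul_of_nonneg_right ?_ (abs_nonneg _)
    have := abs_sub τ q'
    linarith
  rcases hp.eq_or_lt with h0 | h0
  · rw [← h0, zero_mul]; positivity
  rcases hp'.eq_or_lt with h0' | h0'
  -- With `p' = 0` there is no optimal threshold for `q'`, but then `|p - p'| = p` and the crude
  -- bound on `|q - q'|` suffices.
  · rw [← h0', sub_zero, abs_of_pos h0]
    have := mul_le_mul_of_nonneg_left hqq hp
    linarith
  obtain ⟨τ, hτ, e⟩ := h2 h0
  obtain ⟨τ', hτ', e'⟩ := h2' h0'
  have a1 := h1' τ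
  have a2 := h1 τ'
  have a3 := abs_le.1 (hH τ hτ)
  have a4 := abs_le.1 (hH τ' hτ')
  -- Each optimal threshold is tested in the other problem; the errors are the change in `H` and `(p
  -- - p') * (τ - q')`, up to sign.
  have a5 := hb hτ (e := p - p') rfl
  have a6 := hb hτ' (e := p' - p) (abs_sub_comm _ _)
  rw [← abs_of_nonneg hp, ← abs_mul, abs_of_nonneg hp]
  exact abs_le.2 ⟨by linarith, by linarith⟩

variable {l : ℝ → ℝ} {c α R C : ℝ} {d N b : ℕ}
  {x : Fin N → EuclideanSpace ℝ (Fin d)} {y : Fin N → ℝ} {A : Finset (Fin N)} {z : Fin b → Fin N}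
  {s : ℝ}

lemma bottomCount_le_mul (hc : 0 ≤ c) (m : ℕ) : (bottomCount c m : ℝ) ≤ c * m :=
  Nat.floor_le (by positivity)

lemma mul_lt_bottomCount_add_one (m : ℕ) : c * m < bottomCount c m + 1 :=
  Nat.lt_floor_add_one _

/-- The positions of the sample `z` which belong to `A`. -/
def batchSubset (A : Finset (Fin N)) (z : Fin b → Fin N) : Finset (Fin b) :=
  Finset.univ.filter fun j => z j ∈ A

lemma sampleDeviation_ite (g : Fin N → ℝ) :
    sampleDeviation (fun i => if i ∈ A then g i else 0) z =
      (∑ j ∈ batchSubset A z, g (z j)) / b - (∑ i ∈ A, g i) / N := by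
  rw [sampleDeviation, batchSubset, Finset.sum_filter]
  simp

variable [NeZero N] [NeZero b]

/-- The variational stability bound, with `p` and `p'` the bottom counts divided by `N` and `b`.
Floor rounding costs at most `1 / b ≤ s`, whence `|p - p'| ≤ 2 * s`. -/
lemma abs_bottomMean_scores_sub_le (hc : 0 < c) (hc1 : c ≤ 1) (hα : α * N ≤ A.card) (hbN : b ≤ N)
    (hR : 0 ≤ R) (hC : 0 ≤ C) (hx : ∀ i, ‖x i‖ ≤ R) (hs : 1 / (b : ℝ) ≤ s)
    {w : EuclideanSpace ℝ (Fin d)} (hw : ‖w‖ ≤ C)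
    (hdev : ∀ τ, |τ| ≤ C * R → |sampleDeviation
      (fun i => if i ∈ A then max (τ - ⟪w, x i⟫) 0 else 0) z| ≤ 4 * (C * R) * s)
    (hA : |sampleDeviation (fun i => if i ∈ A then 1 else 0) z| ≤ s) :
    c * α * |bottomMean c (scores x A w) -
      bottomMean c (scores (fun j => x (z j)) (batchSubset A z) w)| ≤ 10 * (C * R) * s := by
  have hb : (0 : ℝ) < b := by exact_mod_cast Nat.pos_of_neZero b
  have hN : (0 : ℝ) < N := by exact_mod_cast Nat.pos_of_neZero N
  have hs0 : 0 ≤ s := le_trans (by positivity) hs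
  have hNs : 1 / (N : ℝ) ≤ s :=
    (one_div_le_one_div_of_le hb (by exact_mod_cast hbN)).trans hs
  set A' := batchSubset A z
  set q := bottomMean c (scores x A w) with hq
  set q' := bottomMean c (scores (fun j => x (z j)) A' w) with hq'
  have hqB : |q| ≤ C * R := abs_bottomMean_le hc1 _ (by positivity)
    fun s hs => abs_le_of_mem_scores A hx hw hs
  have hqB' : |q'| ≤ C * R := abs_bottomMean_le hc1 _ (by positivity)
    fun s hs => abs_le_of_mem_scores A' (fun j => hx (z j)) hw hs
  have hqq : |q - q'| ≤ 2 * (C * R) := by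
    have := abs_sub q q'
    linarith
  have variational : ∀ {m : ℕ} (x' : Fin m → EuclideanSpace ℝ (Fin d)) (D : Finset (Fin m)),
      (0 : ℝ) < m → (∀ i, ‖x' i‖ ≤ R) →
      (∀ τ, bottomCount c D.card / (m : ℝ) * τ - (∑ i ∈ D, max (τ - ⟪w, x' i⟫) 0) / m ≤
        bottomCount c D.card / (m : ℝ) * bottomMean c (scores x' D w)) ∧
      (0 < bottomCount c D.card / (m : ℝ) → ∃ τ, |τ| ≤ C * R ∧
        bottomCount c D.card / (m : ℝ) * bottomMean c (scores x' D w) =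
          bottomCount c D.card / (m : ℝ) * τ - (∑ i ∈ D, max (τ - ⟪w, x' i⟫) 0) / m) := by
    intro m x' D hm hx'
    refine ⟨fun τ => ?_, fun hpos => ?_⟩
    · have h := le_bottomCount_mul_bottomMean hc1 (scores x' D w) τ
      rw [card_scores, sum_map_scores] at h
      rw [div_mul_eq_mul_div, div_mul_eq_mul_div, ← sub_div]
      exact div_le_div_of_nonneg_right h hm.le
    · have hk : 0 < bottomCount c D.card := by
        rw [div_pos_iff_of_pos_right hm] at hpos
        exact_mod_cast hpos
      obtain ⟨τ, hτ, h⟩ := exists_bottomCount_mul_bottomMean_eq hc1 (scores x' D w) (by simpa)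
      rw [card_scores, sum_map_scores] at h
      refine ⟨τ, abs_le_of_mem_scores D hx' hw hτ, ?_⟩
      rw [div_mul_eq_mul_div, div_mul_eq_mul_div, ← sub_div, h]
  obtain ⟨v1, v2⟩ := variational x A hN hx
  obtain ⟨v1', v2'⟩ := variational (fun j => x (z j)) A' hb fun j => hx (z j)
  set p : ℝ := bottomCount c A.card / (N : ℝ) with hp
  set p' : ℝ := bottomCount c A'.card / (b : ℝ) with hp'
  have key := mul_abs_sub_le_of_variational (p := p) (p' := p') (by positivity) (by positivity)
    hqB' hqq (show 0 ≤ 4 * (C * R) * s by positivity) v1 v1' v2 v2' (fun τ hτ => by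
      have := hdev τ hτ
      rwa [sampleDeviation_ite fun i => max (τ - ⟪w, x i⟫) 0] at this)
  rw [sampleDeviation_ite fun _ => (1 : ℝ)] at hA
  simp only [Finset.sum_const, nsmul_eq_mul, mul_one] at hA
  have hA' := abs_le.1 hA
  have b1 : p ≤ c * (A.card / N) := by
    rw [hp, ← mul_div_assoc]
    exact div_le_div_of_nonneg_right (bottomCount_le_mul hc.le _) hN.le
  have b2 : p' ≤ c * (A'.card / b) := by
    rw [hp', ← mul_div_assoc]
    exact div_le_div_of_nonneg_right (bottomCount_le_mul hc.le _) hb.le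
  have b3 : c * (A.card / N) ≤ p + 1 / N := by
    rw [hp, ← mul_div_assoc, ← add_div]
    exact div_le_div_of_nonneg_right (mul_lt_bottomCount_add_one _).le hN.le
  have b4 : c * (A'.card / b) ≤ p' + 1 / b := by
    rw [hp', ← mul_div_assoc, ← add_div]
    exact div_le_div_of_nonneg_right (mul_lt_bottomCount_add_one _).le hb.le
  have b5 : c * s ≤ s := mul_le_of_le_one_left hs0 hc1
  have b6 := mul_le_mul_of_nonneg_left hA'.1 hc.le
  have b7 := mul_le_mul_of_nonneg_left hA'.2 hc.le
  have hpp : |p - p'| ≤ 2 * s := abs_le.2 ⟨by linarith, by linarith⟩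
  have b8 : α ≤ A.card / N := (le_div_iff₀ hN).2 hα
  have b9 := mul_le_mul_of_nonneg_left b8 hc.le
  have hCR : 0 ≤ C * R := by positivity
  -- Since `A` has proportion at least `α`, `c * α ≤ p + s`. This also covers `p = 0`, where the
  -- quantile is `0` by convention.
  calc c * α * |q - q'| ≤ (p + s) * |q - q'| :=
        mul_le_mul_of_nonneg_right (by linarith) (abs_nonneg _)
    _ = p * |q - q'| + s * |q - q'| := by ring
    _ ≤ (4 * (C * R) * s + 2 * (C * R) * (2 * s)) + s * (2 * (C * R)) := by
        have := mul_le_mul_of_nonneg_left hpp (show 0 ≤ 2 * (C * R) by positivity)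
        have := mul_le_mul_of_nonneg_left hqq hs0
        linarith
    _ = _ := by ring

/-- The constant in the uniform deviation bound for the quantile loss. -/
noncomputable def deviationConst (l : ℝ → ℝ) (Λ : ℝ≥0) (c α R C : ℝ) : ℝ :=
  8 * (Λ + 1) * (C * R) + 2 * (|l 0| + 1) + 2 * Λ * (10 * (C * R) / (c * α))

lemma abs_batchLoss_sub_le {Λ : ℝ≥0} (hl : LipschitzWith Λ l) (hc : 0 < c) (hc1 : c ≤ 1)
    (hα0 : 0 < α) (hα : α * N ≤ A.card) (hbN : b ≤ N)
    (hR : 0 ≤ R) (hC : 0 ≤ C) (hx : ∀ i, ‖x i‖ ≤ R) (hy : ∀ i, y i = -1 ∨ y i = 1)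
    (hs : 1 / (b : ℝ) ≤ s) {w : EuclideanSpace ℝ (Fin d)} (hw : ‖w‖ ≤ C)
    (h1 : ∀ a, |a| ≤ C * R → |sampleDeviation
      (fun i => (1 - y i) * (l (⟪w, x i⟫ - a) - l 0)) z| ≤ 4 * (2 * (Λ + 1)) * (C * R) * s)
    (h2 : |sampleDeviation (fun i => (1 - y i) * l 0) z| ≤ (|l 0| + 1) * 2 * s)
    (h3 : ∀ τ, |τ| ≤ C * R → |sampleDeviation
      (fun i => if i ∈ A then max (τ - ⟪w, x i⟫) 0 else 0) z| ≤ 4 * (C * R) * s)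
    (h4 : |sampleDeviation (fun i => if i ∈ A then 1 else 0) z| ≤ s) :
    |batchLoss l c x y A z w - quantileLoss l c x y A w| ≤ deviationConst l Λ c α R C * s := by
  have hq := abs_bottomMean_scores_sub_le hc hc1 hα hbN hR hC hx hs hw h3 h4
  have hb : (0 : ℝ) < b := by exact_mod_cast Nat.pos_of_neZero b
  set q := bottomMean c (scores x A w) with hqdef
  set q' := bottomMean c (scores (fun j => x (z j)) (batchSubset A z) w) with hqdef'
  have hqB : |q| ≤ C * R := abs_bottomMean_le hc1 _ (by positivity)
    fun s hs => abs_le_of_mem_scores A hx hw hs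
  have h1q := h1 q hqB
  have hcα : 0 < c * α := by positivity
  have hq2 : |q - q'| ≤ 10 * (C * R) / (c * α) * s := by
    rw [div_mul_eq_mul_div, le_div_iff₀ hcα, mul_comm]
    exact hq
  have hbatch : batchLoss l c x y A z w = (∑ j, (1 - y (z j)) * l (⟪w, x (z j)⟫ - q')) / b := rfl
  have hfull : quantileLoss l c x y A w = (∑ i, (1 - y i) * l (⟪w, x i⟫ - q)) / N := rfl
  -- Exchange `q'` for `q` in the batch first, at Lipschitz cost, then compare means with the same
  -- offset `q`. Contraction needs functions vanishing at `0`, so `l 0` is split off.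
  have hdecomp : batchLoss l c x y A z w - quantileLoss l c x y A w =
      (∑ j, (1 - y (z j)) * (l (⟪w, x (z j)⟫ - q') - l (⟪w, x (z j)⟫ - q))) / b +
      (sampleDeviation (fun i => (1 - y i) * (l (⟪w, x i⟫ - q) - l 0)) z +
        sampleDeviation (fun i => (1 - y i) * l 0) z) := by
    rw [← sampleDeviation_add, hbatch, hfull, sampleDeviation]
    simp only [mul_sub, sub_add_cancel, Finset.sum_sub_distrib]
    ring
  have hterm : |(∑ j, (1 - y (z j)) * (l (⟪w, x (z j)⟫ - q') - l (⟪w, x (z j)⟫ - q))) / b| ≤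
      2 * (Λ * |q - q'|) := by
    rw [abs_div, Nat.abs_cast]
    refine le_trans (div_le_div_of_nonneg_right (Finset.abs_sum_le_sum_abs _ _) hb.le)
      (sum_div_le_of_forall_le (by positivity) fun j => ?_)
    rw [abs_mul, abs_of_nonneg (one_sub_nonneg_of_label (hy _))]
    refine mul_le_mul (one_sub_le_two_of_label (hy _)) ?_ (abs_nonneg _) (by norm_num)
    refine (abs_sub_le_mul_of_lipschitzWith hl _ _).trans (le_of_eq ?_)
    congr 2; ring
  have hΛ := mul_le_mul_of_nonneg_left hq2 Λ.2
  have hΛ' : (Λ : ℝ) * |q - q'| ≤ Λ * (10 * (C * R) / (c * α) * s) := hΛ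
  rw [hdecomp]
  refine (abs_add_le _ _).trans ?_
  have h5 := abs_add_le (sampleDeviation (fun i => (1 - y i) * (l (⟪w, x i⟫ - q) - l 0)) z)
    (sampleDeviation (fun i => (1 - y i) * l 0) z)
  rw [deviationConst]
  have e : (8 * ((Λ : ℝ) + 1) * (C * R) + 2 * (|l 0| + 1) +
      2 * Λ * (10 * (C * R) / (c * α))) * s =
      2 * (Λ * (10 * (C * R) / (c * α) * s)) +
      (4 * (2 * (Λ + 1)) * (C * R) * s + (|l 0| + 1) * 2 * s) := by ring
  rw [e]
  linarith

/-- With all but exponentially small probability, the minibatch loss is uniformly close to the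
full loss. -/
theorem card_batchLoss_deviation_le {Λ : ℝ≥0} (hl : LipschitzWith Λ l) (hc : 0 < c) (hc1 : c ≤ 1)
    (hα0 : 0 < α) (hα : α * N ≤ A.card) (hbN : b ≤ N)
    (hR : 0 < R) (hC : 0 < C) (hx : ∀ i, ‖x i‖ ≤ R) (hy : ∀ i, y i = -1 ∨ y i = 1)
    (hs : 1 / (b : ℝ) ≤ s) {B S : Finset (Fin b → Fin N)} (hBS : B ⊆ S) (hS : IsSamplingScheme S)
    (hB : ∀ z ∈ B, ∃ w : EuclideanSpace ℝ (Fin d), ‖w‖ ≤ C ∧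
      deviationConst l Λ c α R C * s < |batchLoss l c x y A z w - quantileLoss l c x y A w|) :
    (B.card : ℝ) ≤ S.card * (16 * Real.exp (-(b * s ^ 2 / 8))) := by
  classical
  have hs0 : 0 ≤ s := le_trans (by positivity) hs
  set B₁ := B.filter fun z => ∃ (w : EuclideanSpace ℝ (Fin d)) (a : ℝ), ‖w‖ ≤ C ∧ |a| ≤ C * R ∧
    4 * (2 * ((Λ : ℝ) + 1)) * (C * R) * s <
      |sampleDeviation (fun i => (1 - y i) * (l (⟪w, x i⟫ - a) - l 0)) z|
  set B₂ := B.filter fun z => (|l 0| + 1) * 2 * s < |sampleDeviation (fun i => (1 - y i) * l 0) z|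
  set B₃ := B.filter fun z => ∃ (w : EuclideanSpace ℝ (Fin d)) (a : ℝ), ‖w‖ ≤ C ∧ |a| ≤ C * R ∧
    4 * 1 * (C * R) * s < |sampleDeviation
      (fun i => if i ∈ A then max (-(⟪w, x i⟫ - a)) 0 else 0) z|
  set B₄ := B.filter fun z => 1 * 1 * s <
    |sampleDeviation (fun i => (if i ∈ A then 1 else 0) * 1) z|
  have hsub : B ⊆ B₁ ∪ B₂ ∪ B₃ ∪ B₄ := by
    intro z hz
    by_contra hcon
    simp only [Finset.mem_union, not_or] at hcon
    obtain ⟨⟨⟨n1, n2⟩, n3⟩, n4⟩ := hcon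
    obtain ⟨w, hw, hlt⟩ := hB z hz
    refine absurd (abs_batchLoss_sub_le hl hc hc1 hα0 hα hbN hR.le hC.le hx hy hs hw ?_ ?_ ?_ ?_)
      (not_le.2 hlt)
    · intro a ha
      by_contra! h
      exact n1 (Finset.mem_filter.2 ⟨hz, w, a, hw, ha, h⟩)
    · by_contra! h
      exact n2 (Finset.mem_filter.2 ⟨hz, h⟩)
    · intro a ha
      by_contra! h
      refine n3 (Finset.mem_filter.2 ⟨hz, w, a, hw, ha, ?_⟩)
      simpa using h
    · by_contra! h
      refine n4 (Finset.mem_filter.2 ⟨hz, ?_⟩)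
      simpa using h
  have hlab : ∀ i, |1 - y i| ≤ 2 := fun i => by
    rw [abs_of_nonneg (one_sub_nonneg_of_label (hy i))]
    exact one_sub_le_two_of_label (hy i)
  have c1 := card_affine_deviation_le ((Finset.filter_subset _ _).trans hBS) hS hs0 hR hC
    (show 0 < 2 * ((Λ : ℝ) + 1) by positivity) hx (fun i u => (1 - y i) * (l u - l 0))
    (fun i => by simp) (fun i u u' => by
      rw [← mul_sub, sub_sub_sub_cancel_right, abs_mul, mul_assoc]
      refine mul_le_mul (hlab i) ?_ (abs_nonneg _) (by norm_num)
      refine (abs_sub_le_mul_of_lipschitzWith hl u u').trans ?_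
      exact mul_le_mul_of_nonneg_right (by linarith) (abs_nonneg _))
    (B := B₁) (fun z hz => (Finset.mem_filter.1 hz).2)
  have c2 := card_scalar_deviation_le ((Finset.filter_subset _ _).trans hBS) hS hs0
    (fun i => 1 - y i) (show 0 < |l 0| + 1 by positivity) two_pos (t := l 0) (by linarith) hlab
    (B := B₂) (fun z hz => (Finset.mem_filter.1 hz).2)
  have c3 := card_affine_deviation_le ((Finset.filter_subset _ _).trans hBS) hS hs0 hR hC
    one_pos hx (fun i u => if i ∈ A then max (-u) 0 else 0)
    (fun i => by simp) (fun i u u' => by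
      split_ifs
      · rw [one_mul]
        refine (abs_max_sub_max_le_abs (-u) (-u') 0).trans (le_of_eq ?_)
        rw [neg_sub_neg, abs_sub_comm]
      · simp)
    (B := B₃) (fun z hz => (Finset.mem_filter.1 hz).2)
  have c4 := card_scalar_deviation_le ((Finset.filter_subset _ _).trans hBS) hS hs0
    (fun i => if i ∈ A then 1 else 0) one_pos one_pos (t := 1) (by simp)
    (fun i => by split_ifs <;> simp)
    (B := B₄) (fun z hz => (Finset.mem_filter.1 hz).2)
  -- Four deviation events, each two-sided and each side with the factor 2 from `exp ≤ 2 * cosh`,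
  -- give the 16.
  have hcard : (B.card : ℝ) ≤ B₁.card + B₂.card + B₃.card + B₄.card := by
    have h := (Finset.card_le_card hsub).trans (Finset.card_union_le _ _)
    have h' := Finset.card_union_le (B₁ ∪ B₂) B₃
    have h'' := Finset.card_union_le B₁ B₂
    exact_mod_cast (show B.card ≤ B₁.card + B₂.card + B₃.card + B₄.card by omega)
  linarith

end Stability

section Probability

/-! ### From counting to probability, and the resulting bound for a run -/

variable {l : ℝ → ℝ} {c α R C : ℝ} {d N b T : ℕ}
  {x : Fin N → EuclideanSpace ℝ (Fin d)} {y : Fin N → ℝ} {A : Finset (Fin N)}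

/-- Under a uniform law, counting bad samples bounds the probability. -/
lemma measure_le_of_card_le {Ω β : Type*} [MeasurableSpace Ω] {μ : Measure Ω} [Fintype β]
    [MeasurableSpace β] [MeasurableSingletonClass β] {X : Ω → β} {S : Finset β} (hS : S.Nonempty)
    (hX : HasLaw X (uniformOn (S : Set β)) μ) {p : ℝ} (P : β → Prop)
    (h : ∀ B ⊆ S, (∀ z ∈ B, P z) → (B.card : ℝ) ≤ S.card * p) :
    μ {ω | P (X ω)} ≤ ENNReal.ofReal p := by
  classical
  have hc : (0 : ℝ) < S.card := by exact_mod_cast hS.card_pos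
  refine (Measure.le_map_apply hX.aemeasurable {z | P z}).trans ?_
  have e : {z | P z} = ((Finset.univ.filter P : Finset β) : Set β) := by ext; simp
  rw [hX.map_eq, e, uniformOn_apply_finset]
  have h' := h (S ∩ Finset.univ.filter P) Finset.inter_subset_left
    fun z hz => (Finset.mem_filter.1 (Finset.mem_inter.1 hz).2).2
  rw [← ENNReal.ofReal_natCast, ← ENNReal.ofReal_natCast, ← ENNReal.ofReal_div_of_pos hc]
  exact ENNReal.ofReal_le_ofReal ((div_le_iff₀ hc).2 (by linarith))

theorem measure_batchLoss_deviation_le [NeZero N] [NeZero b] {Λ : ℝ≥0} (hl : LipschitzWith Λ l)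
    (hc : 0 < c) (hc1 : c ≤ 1) (hα0 : 0 < α) (hα : α * N ≤ A.card) (hbN : b ≤ N)
    (hR : 0 < R) (hC : 0 < C) (hx : ∀ i, ‖x i‖ ≤ R) (hy : ∀ i, y i = -1 ∨ y i = 1) {s : ℝ}
    (hs : 1 / (b : ℝ) ≤ s) {Ω : Type*} [MeasurableSpace Ω] {μ : Measure Ω}
    {Z : ℕ → Ω → Fin b → Fin N} (hZ : IsMinibatchSampling μ T Z) {t : ℕ} (ht : t < T) :
    μ {ω | ∃ w : EuclideanSpace ℝ (Fin d), ‖w‖ ≤ C ∧ deviationConst l Λ c α R C * s <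
      |batchLoss l c x y A (Z t ω) w - quantileLoss l c x y A w|} ≤
      ENNReal.ofReal (16 * Real.exp (-(b * s ^ 2 / 8))) := by
  classical
  rcases hZ with hZ | hZ
  · refine measure_le_of_card_le (S := Finset.univ) Finset.univ_nonempty
      (by simpa using hZ t ht)
      (fun z => ∃ w : EuclideanSpace ℝ (Fin d), ‖w‖ ≤ C ∧ deviationConst l Λ c α R C * s <
        |batchLoss l c x y A z w - quantileLoss l c x y A w|) fun B hB h => ?_
    exact card_batchLoss_deviation_le hl hc hc1 hα0 hα hbN hR hC hx hy hs hB (Or.inl rfl) h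
  · refine measure_le_of_card_le
      (S := Finset.univ.filter fun z : Fin b → Fin N => Function.Injective z)
      ⟨Fin.castLE hbN, by simpa using Fin.castLE_injective hbN⟩ (by simpa using hZ t ht)
      (fun z => ∃ w : EuclideanSpace ℝ (Fin d), ‖w‖ ≤ C ∧ deviationConst l Λ c α R C * s <
        |batchLoss l c x y A z w - quantileLoss l c x y A w|) fun B hB h => ?_
    exact card_batchLoss_deviation_le hl hc hc1 hα0 hα hbN hR hC hx hy hs hB
      (Or.inr fun z => by simp) h

/-- If all minibatch losses are uniformly `ε`-close to the full loss, then the averaged iterate is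
nearly optimal for the full loss. -/
theorem quantileLoss_averageIterate_le {Λ : ℝ≥0} (hl_convex : ConvexOn ℝ Set.univ l)
    (hl_mono : Monotone l) (hl : LipschitzWith Λ l) (hc1 : c ≤ 1) (hR : 0 ≤ R) (hC : 0 ≤ C)
    (hx : ∀ i, ‖x i‖ ≤ R) (hy : ∀ i, y i = -1 ∨ y i = 1) {γ₀ : ℝ} (hγ : 0 < γ₀) (hT : 0 < T)
    {z : ℕ → Fin b → Fin N} {w : ℕ → EuclideanSpace ℝ (Fin d)}
    (hw : IsSGDRun (fun t => batchLoss l c x y A (z t)) C (γ₀ / √T) T w) {ε : ℝ}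
    (hε : ∀ t < T, ∀ v : EuclideanSpace ℝ (Fin d), ‖v‖ ≤ C →
      |batchLoss l c x y A (z t) v - quantileLoss l c x y A v| ≤ ε)
    {v : EuclideanSpace ℝ (Fin d)} (hv : ‖v‖ ≤ C) :
    quantileLoss l c x y A (averageIterate T w) ≤ quantileLoss l c x y A v + 2 * ε +
      (2 * C ^ 2 / γ₀ + γ₀ * (4 * Λ * R) ^ 2 / 2) * √(1 / T) := by
  have hT' : (0 : ℝ) < T := by exact_mod_cast hT
  have hsT : 0 < √(T : ℝ) := Real.sqrt_pos.2 hT'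
  have hreg := hw.sum_sub_le hC (by positivity) (show 0 ≤ 4 * Λ * R by positivity)
    (fun t _ u u' => quantileLoss_sub_le hl hc1 (fun j => hy _) _ hR (fun j => hx _) u u') hv
  have hJ := (convexOn_quantileLoss (x := x) hl_convex hl_mono hc1 hy A).map_sum_le
    (t := Finset.range T) (w := fun _ => (T : ℝ)⁻¹) (p := w) (fun _ _ => by positivity)
    (by simp [hT'.ne']) (fun _ _ => trivial)
  rw [← Finset.smul_sum, ← Finset.smul_sum, smul_eq_mul] at hJ
  -- The uniform error is paid twice, at the iterate `w t` and at the comparator `v`.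
  have hsum : ∑ t ∈ Finset.range T, quantileLoss l c x y A (w t) ≤
      ∑ t ∈ Finset.range T, ((quantileLoss l c x y A v + 2 * ε) +
        (batchLoss l c x y A (z t) (w t) - batchLoss l c x y A (z t) v)) := by
    refine Finset.sum_le_sum fun t ht => ?_
    have ht' := Finset.mem_range.1 ht
    have h1 := abs_le.1 (hε t ht' (w t) (hw.norm_le hC ht'.le))
    have h2 := abs_le.1 (hε t ht' v hv)
    linarith
  rw [Finset.sum_add_distrib, Finset.sum_const, Finset.card_range, nsmul_eq_mul] at hsum
  refine hJ.trans ((mul_le_mul_of_nonneg_left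
    (hsum.trans (add_le_add_right hreg _)) (by positivity)).trans (le_of_eq ?_))
  have hsq : (T : ℝ) = √T * √T := (Real.mul_self_sqrt hT'.le).symm
  rw [Real.sqrt_div zero_le_one, Real.sqrt_one, mul_add, inv_mul_cancel_left₀ hT'.ne']
  congr 1
  generalize √(T : ℝ) = r at hsT hsq
  rw [hsq]
  field_simp

/-- Four of the five powers of `r ≥ 2` absorb the factor `16 = 2 ^ 4`. -/
lemma sixteen_mul_exp_le {r : ℝ} (hr : 2 ≤ r) : 16 * Real.exp (-(5 * Real.log r)) ≤ r⁻¹ := by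
  have hr0 : 0 < r := by linarith
  have e : Real.exp (-(5 * Real.log r)) = (r ^ 5)⁻¹ := by
    rw [Real.exp_neg, show 5 * Real.log r = Real.log (r ^ 5) by rw [Real.log_pow]; norm_num,
      Real.exp_log (by positivity)]
  rw [e, ← div_eq_mul_inv, div_le_iff₀ (by positivity)]
  have h : (2 : ℝ) ^ 4 ≤ r ^ 4 := pow_le_pow_left₀ (by norm_num) hr 4
  have e' : r⁻¹ * r ^ 5 = r ^ 4 := by field_simp
  rw [e']
  linarith

lemma one_div_le_sqrt_log_div {r : ℝ} (hr : 2 ≤ r) (hb : 1 ≤ b) :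
    1 / (b : ℝ) ≤ √(40 * Real.log r / b) := by
  have hb' : (1 : ℝ) ≤ b := by exact_mod_cast hb
  refine Real.le_sqrt_of_sq_le ?_
  have h1 : 1 ≤ 40 * Real.log r := by
    have := Real.log_le_log two_pos hr
    have := Real.log_two_gt_d9
    linarith
  rw [div_pow, one_pow, div_le_div_iff₀ (by positivity) (by positivity)]
  nlinarith

end Probability

end QuantileSGD

/-! ### The convergence theorem -/

theorem mainTheorem2
    (l : ℝ → ℝ) (hl_convex : ConvexOn ℝ Set.univ l) (hl_mono : Monotone l)
    (Λ : ℝ≥0) (hl_lip : LipschitzWith Λ l)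
    (c α R C γ₀ : ℝ) (hc : 0 < c) (hc1 : c ≤ 1) (hα : 0 < α) (hR : 0 < R) (hC : 0 < C)
    (hγ : 0 < γ₀) :
    ∃ K₁ K₂ : ℝ, ∀ (d N b T : ℕ), 1 ≤ b → b ≤ N → 1 ≤ T →
      ∀ (x : Fin N → EuclideanSpace ℝ (Fin d)) (y : Fin N → ℝ) (A : Finset (Fin N)),
      (∀ i, ‖x i‖ ≤ R) → (∀ i, y i = -1 ∨ y i = 1) → α * N ≤ A.card →
      ∀ (Ω : Type*) [MeasurableSpace Ω] (μ : Measure Ω) [IsProbabilityMeasure μ]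
        (Z : ℕ → Ω → Fin b → Fin N) (w : ℕ → Ω → EuclideanSpace ℝ (Fin d)),
      QuantileSGD.IsMinibatchSampling μ T Z →
      (∀ ω, QuantileSGD.IsSGDRun (fun t => QuantileSGD.batchLoss l c x y A (Z t ω))
        C (γ₀ / √T) T (fun t => w t ω)) →
      ∀ δ : ℝ, 0 < δ → δ < 1 →
      μ {ω | ¬ ∀ v : EuclideanSpace ℝ (Fin d), ‖v‖ ≤ C →
        QuantileSGD.quantileLoss l c x y A (QuantileSGD.averageIterate T fun t => w t ω) ≤
          QuantileSGD.quantileLoss l c x y A v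
            + K₁ * √(Real.log (T / δ) / b) + K₂ * √(1 / T)} ≤ ENNReal.ofReal δ := by
  set M : ℝ := 2 * (|l 0| + Λ * (2 * (C * R)))
  set K := QuantileSGD.deviationConst l Λ c α R C with hK
  have hK0 : 0 ≤ K := by
    rw [hK, QuantileSGD.deviationConst]
    positivity
  have hM0 : 0 ≤ M := by positivity
  refine ⟨2 * K * √40, 2 * C ^ 2 / γ₀ + γ₀ * (4 * Λ * R) ^ 2 / 2 + 2 * M, ?_⟩
  intro d N b T hb hbN hT x y A hx hy hA Ω _ μ _ Z w hZ hw δ hδ hδ1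
  have : NeZero b := ⟨by omega⟩
  have : NeZero N := ⟨by omega⟩
  have hT0 : (0 : ℝ) < T := by exact_mod_cast hT
  rcases hT.eq_or_lt with rfl | hT2
  -- For `T = 1` and `δ` near `1` the logarithm is too small to absorb the factor 16. Boundedness of
  -- the loss by `M` makes the claim hold surely, through the summand `2 * M` of `K₂`.
  · refine le_of_eq_of_le ?_ zero_le
    convert measure_empty (μ := μ)
    refine Set.eq_empty_of_forall_notMem fun ω hω => hω fun v hv => ?_
    have h1 := abs_le.1 (QuantileSGD.abs_quantileLoss_le (x := x) hl_lip hc1 hy A hR.le hC.le hx hv)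
    have h2 := abs_le.1 (QuantileSGD.abs_quantileLoss_le (x := x) hl_lip hc1 hy A hR.le hC.le hx
      (QuantileSGD.norm_averageIterate_le hC.le fun t ht => (hw ω).norm_le hC.le ht.le))
    have h3 : 0 ≤ 2 * K * √40 * √(Real.log ((1 : ℕ) / δ) / b) := by positivity
    have h4 : 0 ≤ 2 * C ^ 2 / γ₀ + γ₀ * (4 * Λ * R) ^ 2 / 2 := by positivity
    simp only [Nat.cast_one, div_one, Real.sqrt_one, mul_one] at h3 ⊢
    linarith [h1.1, h2.2]
  have hr : 2 ≤ (T : ℝ) / δ := by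
    rw [le_div_iff₀ hδ]
    have : (2 : ℝ) ≤ T := by exact_mod_cast hT2
    linarith
  -- `40 = 8 * 5` turns the tail exponent `b * s ^ 2 / 8` into `5 * log (T / δ)`, so each step fails
  -- with probability at most `δ / T`.
  set s := √(40 * Real.log (T / δ) / b) with hs
  have hsb := QuantileSGD.one_div_le_sqrt_log_div hr hb
  have hb0 : (0 : ℝ) < b := by exact_mod_cast hb
  have hlog : 0 ≤ Real.log (T / δ) := Real.log_nonneg (by linarith)
  have hs2 : b * s ^ 2 / 8 = 5 * Real.log (T / δ) := by
    rw [hs, Real.sq_sqrt (by positivity)]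
    field_simp
    ring
  have hbad : ∀ t ∈ Finset.range T, μ {ω | ∃ w : EuclideanSpace ℝ (Fin d), ‖w‖ ≤ C ∧
      K * s < |QuantileSGD.batchLoss l c x y A (Z t ω) w - QuantileSGD.quantileLoss l c x y A w|} ≤
      ENNReal.ofReal (δ / T) := fun t ht => by
    refine (QuantileSGD.measure_batchLoss_deviation_le hl_lip hc hc1 hα hA hbN hR hC hx hy hsb hZ
      (Finset.mem_range.1 ht)).trans (ENNReal.ofReal_le_ofReal ?_)
    rw [hs2, ← inv_div (T : ℝ) δ]
    exact QuantileSGD.sixteen_mul_exp_le hr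
  -- The covering events involve only the minibatches, so the iterates need not be measurable.
  refine (measure_mono (t := ⋃ t ∈ Finset.range T, {ω | ∃ w : EuclideanSpace ℝ (Fin d), ‖w‖ ≤ C ∧
    K * s < |QuantileSGD.batchLoss l c x y A (Z t ω) w - QuantileSGD.quantileLoss l c x y A w|})
    fun ω hω => ?_).trans ((measure_biUnion_finset_le _ _).trans
      ((Finset.sum_le_sum hbad).trans (le_of_eq ?_)))
  · by_contra hcon
    simp only [Set.mem_iUnion, Set.mem_ofPred_eq, not_exists, not_and, not_lt] at hcon
    refine hω fun v hv => ?_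
    have h := QuantileSGD.quantileLoss_averageIterate_le hl_convex hl_mono hl_lip hc1 hR.le hC.le
      hx hy hγ hT (hw ω) (fun t ht => hcon t (Finset.mem_range.2 ht)) hv
    have e : s = √40 * √(Real.log (T / δ) / b) := by
      rw [hs, mul_div_assoc, Real.sqrt_mul (by norm_num)]
    have h5 : 0 ≤ 2 * M * √(1 / (T : ℝ)) := by positivity
    rw [e] at h
    linarith
  · rw [Finset.sum_const, Finset.card_range, ← ENNReal.ofReal_nsmul, nsmul_eq_mul,
      mul_div_cancel₀ _ hT0.ne']
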